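/- **Setting.** Let $K\subset\mathbb C=\mathbb R^2$ be the quadratic Koch curve of type II with end points $0,1$, i.e. the attractor of the eight similarities $z\mapsto a_j+\tfrac{w_j}{4}z$ with $(a_j)=(0,\tfrac14,\tfrac{1+i}4,\tfrac{2+i}4,\tfrac12,\tfrac{2-i}4,\tfrac{3-i}4,\tfrac34)$ and $(w_j)=(1,i,1,-i,-i,1,i,1)$ (dimension $3/2$). Let $\Gamma$ be the closed curve obtained by replacing the four sides of the unit square by copies of $K$, i.e. $\Gamma=K\cup(1+iK)\cup(1+i-K)\cup(i-iK)$; it is circumscribed by the square $Q=[-\tfrac13,\tfrac43]^2$. Let $D$ be the domain bounded by $\Gamma$ (the points off $\Gamma$ whose component in $\mathbb C\setminus\Gamma$ is bounded). Let $\Gamma^{*}=\bigcup_{k\in\mathbb Z}(\Gamma+\tfrac53k)$ and let $dv$ be the measure on $\mathbb R$ given by $dv(B)=\mathcal H^{3/2}(\Gamma^{*}\cap\{\operatorname{Re}z\in B\})/\mathcal H^{3/2}(\Gamma)$. The integral staircase with base point $p$ is $S_p(\xi)=dv((p,\xi))$ for $\xi\ge p$ and $S_p(\xi)=-dv((\xi,p))$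 for $\xi<p$. The scaling variables are $v(T)=S_0(T)$, $v(x)=S_{-1/3}(x)$, $v(y)=S_{-1/3}(y)$. The fractal derivative of $f$ at $a$ with respect to $v$ is $\frac{d^\gamma f}{ds^\gamma}(a)=\lim_{\Delta v\to0,\ \Delta v\ne 0}\frac{\Delta f}{\Delta v}$; fractal partial derivatives in $T,x,y$ are taken with respect to $v(T),v(x),v(y)$. A function is $n$ times continuously differentiable in the fractal sense on a set if all its fractal partial derivatives of order $\le n$ (mixed ones included) exist and are continuous there. The fractal wave equation with fractal wave velocity $\kappa>0$ is $$\frac{\partial^{2\gamma}U}{\partial T^{2\gamma}}=\kappa^2\Big(\frac{\partial^{2\gamma}U}{\partial x^{2\gamma}}+\frac{\partial^{2\gamma}U}{\partial y^{2\gamma}}\Big).$$ **Theorem.** 1. For every $p\in\mathbb R$, $S_p$ is continuous and strictly increasing, $S_p(p)=0$ and $S_p(\xi+\tfrac53)=S_p(\xi)+1$ for all $\xi$. For all $a,b$, $\mathcal H^{3/2}(\Gamma\cap\{a<\operatorname{Re}z<b\})=\mathcal H^{3/2}(\Gamma\cap\{a<\operatorname{Im}z<b\})$, so the same staircase serves both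 axes. The set $\{T>0,\ (x,y)\in D\}$ is open. 2. (Renormalization.) Let $c,\kappa>0$, let $\mathcal S\subseteq\mathbb R^3$ be open (for instance $\mathcal S=\{T>0,\ (x,y)\in D\}$), let $R(T,x,y)=(\tfrac{\kappa}{c}v(T),v(x),v(y))$, and let $u(t,x,y)$ be $C^2$ on $R(\mathcal S)$. Then $U=u\circ R$ is twice continuously differentiable in the fractal sense on $\mathcal S$, and at every point $P\in\mathcal S$ the function $U$ satisfies the fractal wave equation with velocity $\kappa$ if and only if $u$ satisfies $u_{tt}=c^2(u_{xx}+u_{yy})$ at $R(P)$. 3. For $h:\mathbb R^2\to\mathbb R$ put $A_{m,n}(h)=4\iint_D h(x,y)\sin(\pi m v(x))\sin(\pi n v(y))\,dv(x)\,dv(y)$, $m,n\ge1$. If the (closed) support of $h$ lies in $D$ and $h$ is five times continuously differentiable in the fractal sense, then $\sum_{m,n\ge1}(m^2+n^2)|A_{m,n}(h)|<\infty$. 4. (Series solution.) Let $\kappa>0$ (for instance $\kappa=v(c)=S_0(c)$ with $c>0$) and let real $A_{m,n}$, $m,n\ge1$, satisfy $\sum_{m,n}(m^2+n^2)|A_{m,n}|<\infty$.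 Then the series $$U(T,x,y)=\sum_{m,n\ge1}A_{m,n}\cos\!\big(\pi\kappa\sqrt{m^2+n^2}\,v(T)\big)\sin(\pi m\,v(x))\sin(\pi n\,v(y))$$ converges absolutely at every point; $U$ is continuous and twice continuously differentiable in the fractal sense on $\mathbb R^3$; it satisfies the fractal wave equation with velocity $\kappa$ everywhere, in particular for $T>0$, $(x,y)\in D$; its first fractal $T$-derivative vanishes at $T=0$; and $U=0$ whenever $x$ or $y$ is $-\tfrac13$ or $\tfrac43$. If moreover $h$ is continuous on $\overline D$, vanishes on $\Gamma$, and $A_{m,n}=A_{m,n}(h)$ for all $m,n$, then $U(0,x,y)=h(x,y)$ on $\overline D$. For $\kappa=1$ this is the series $\sum A_{m,n}\cos(\pi\sqrt{m^2+n^2}\,v(T))\sin(\pi m v(x))\sin(\pi n v(y))$. -/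

import Mathlib

open MeasureTheory Filter Topology

namespace KochWave

noncomputable section

/-! ## The quadratic Koch curve (type II), the Koch island and its boundary -/

/-- Starting points of the eight segments of the generator of the quadratic Koch curve of type II,
`0, 1/4, (1+i)/4, (2+i)/4, 1/2, (2-i)/4, (3-i)/4, 3/4`. -/
def kochVertex : Fin 8 → ℂ :=
  ![0, 1 / 4, (1 + Complex.I) / 4, (2 + Complex.I) / 4, 1 / 2, (2 - Complex.I) / 4,
    (3 - Complex.I) / 4, 3 / 4]

/-- Directions of the eight segments (each of length `1/4`) of the generator. -/
def kochDirection : Fin 8 → ℂ :=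
  ![1, Complex.I, 1, -Complex.I, -Complex.I, 1, Complex.I, 1]

/-- The eight similarities, of ratio `1/4`, of the iterated function system. -/
def kochMap (j : Fin 8) (z : ℂ) : ℂ := kochVertex j + kochDirection j / 4 * z

/-- The Hutchinson operator of the iterated function system. -/
def hutchinson (A : Set ℂ) : Set ℂ := ⋃ j : Fin 8, kochMap j '' A

/-- A compact set that the Hutchinson operator maps into itself (see `hutchinson_kochBox_subset`). -/
def kochBox : Set ℂ := {z | 0 ≤ z.re ∧ z.re ≤ 1 ∧ |z.im| ≤ 1 / 3}

theorem hutchinson_kochBox_subset : hutchinson kochBox ⊆ kochBox := by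
  intro w hw
  simp only [hutchinson, Set.mem_iUnion, Set.mem_image] at hw
  obtain ⟨j, z, ⟨h0, h1, h2⟩, rfl⟩ := hw
  rw [abs_le] at h2
  obtain ⟨h2, h3⟩ := h2
  fin_cases j <;>
    simp [kochBox, kochMap, kochVertex, kochDirection, abs_le, Complex.add_re, Complex.mul_re,
      Complex.normSq] <;>
    norm_num <;> (refine ⟨?_, ?_, ?_, ?_⟩ <;> linarith)

/-- The quadratic Koch curve of type II, with end points `0` and `1`: the attractor of the
iterated function system, as the decreasing intersection of the iterates of the Hutchinson
operator on a compact set that it maps into itself. Its similarity dimension is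
`log 8 / log 4 = 3 / 2`. -/
def kochCurve : Set ℂ := ⋂ n : ℕ, hutchinson^[n] kochBox

/-- The closed curve `Γ`: the four sides of the unit square, replaced by quadratic Koch curves. -/
def kochBoundary : Set ℂ :=
  kochCurve ∪ (fun z => 1 + Complex.I * z) '' kochCurve ∪
    (fun z => 1 + Complex.I - z) '' kochCurve ∪ (fun z => Complex.I - Complex.I * z) '' kochCurve

/-- The domain `D` bounded by `Γ`: the points off `Γ` whose connected component in the complement
of `Γ` is bounded (the inside of the Jordan curve `Γ`). -/
def kochDomain : Set ℂ :=
  {z | z ∈ kochBoundaryᶜ ∧ Bornology.IsBounded (connectedComponentIn kochBoundaryᶜ z)}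

/-! ## The integral staircase of `Γ` -/

/-- `Γ` repeated along the first axis with the period `5 / 3`, the side of the square
`[-1/3, 4/3]²` that circumscribes `Γ`. -/
def kochChain : Set ℂ := ⋃ k : ℤ, (fun z => z + (((k : ℝ) * (5 / 3) : ℝ) : ℂ)) '' kochBoundary

/-- The measure `dv`: the `3/2`-dimensional Hausdorff measure of (repeated) `Γ`, projected to the
axis and normalized so that `Γ` has mass one. -/
def massMeasure : Measure ℝ :=
  (Measure.hausdorffMeasure (3 / 2 : ℝ) kochBoundary)⁻¹ •
    ((Measure.hausdorffMeasure (3 / 2 : ℝ)).restrict kochChain).map Complex.re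

/-- The integral staircase function with base point `p`: the signed mass over the interval between
`p` and `ξ`. -/
def staircase (p ξ : ℝ) : ℝ :=
  if p ≤ ξ then (massMeasure (Set.Ioo p ξ)).toReal else -(massMeasure (Set.Ioo ξ p)).toReal

/-- The scaling variables `v(T)`, `v(x)`, `v(y)`. In space the base point is the edge of the
circumscribing square, in time it is `T = 0`. -/
def scalingVar : Fin 3 → ℝ → ℝ :=
  ![staircase 0, staircase (-1 / 3), staircase (-1 / 3)]

/-! ## Fractal derivatives -/

/-- `Δv → 0`, `Δv ≠ 0` at the point `a`. -/
def fractalNhds (v : ℝ → ℝ) (a : ℝ) : Filter ℝ := comap v (𝓝[≠] (v a))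

/-- The fractal derivative of `f` at `a` with respect to `v` exists and equals `d`:
`Δf / Δv → d` as `Δv → 0`. -/
def HasFractalDerivAt (v f : ℝ → ℝ) (d a : ℝ) : Prop :=
  Tendsto (fun s => (f s - f a) / (v s - v a)) (fractalNhds v a) (𝓝 d)

/-- The value of the fractal derivative (meaningful where it exists). -/
def fractalDeriv (v f : ℝ → ℝ) (a : ℝ) : ℝ :=
  limUnder (fractalNhds v a) (fun s => (f s - f a) / (v s - v a))

/-- The fractal partial derivative in the coordinate `i` of `p = (T, x, y)` exists and is `d`. -/
def HasFractalPartialAt (i : Fin 3) (U : (Fin 3 → ℝ) → ℝ) (d : ℝ) (p : Fin 3 → ℝ) : Prop :=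
  HasFractalDerivAt (scalingVar i) (fun s => U (Function.update p i s)) d (p i)

/-- The value of the fractal partial derivative (meaningful where it exists). -/
def fractalPartial (i : Fin 3) (U : (Fin 3 → ℝ) → ℝ) (p : Fin 3 → ℝ) : ℝ :=
  fractalDeriv (scalingVar i) (fun s => U (Function.update p i s)) (p i)

/-- `n` times continuously differentiable in the fractal sense on `S`: all fractal partial
derivatives of order up to `n`, mixed ones included, exist and are continuous on `S`. -/
def FractalContDiffOn : ℕ → ((Fin 3 → ℝ) → ℝ) → Set (Fin 3 → ℝ) → Prop
  | 0, U, S => ContinuousOn U S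
  | n + 1, U, S => ContinuousOn U S ∧ ∀ i : Fin 3, ∃ U' : (Fin 3 → ℝ) → ℝ,
      (∀ p ∈ S, HasFractalPartialAt i U (U' p) p) ∧ FractalContDiffOn n U' S

/-- The local fractal wave equation with fractal wave velocity `κ` at the point `p = (T, x, y)`. -/
def FractalWaveAt (κ : ℝ) (U : (Fin 3 → ℝ) → ℝ) (p : Fin 3 → ℝ) : Prop :=
  fractalPartial 0 (fractalPartial 0 U) p =
    κ ^ 2 * (fractalPartial 1 (fractalPartial 1 U) p + fractalPartial 2 (fractalPartial 2 U) p)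

/-! ## The classical wave equation and the renormalization transformation -/

/-- The ordinary partial derivative in the coordinate `i` of `q = (t, x, y)`. -/
def classicalPartial (i : Fin 3) (u : (Fin 3 → ℝ) → ℝ) (q : Fin 3 → ℝ) : ℝ :=
  deriv (fun s => u (Function.update q i s)) (q i)

/-- The classical wave equation with wave velocity `c` at the point `q = (t, x, y)`. -/
def ClassicalWaveAt (c : ℝ) (u : (Fin 3 → ℝ) → ℝ) (q : Fin 3 → ℝ) : Prop :=
  classicalPartial 0 (classicalPartial 0 u) q =
    c ^ 2 *
      (classicalPartial 1 (classicalPartial 1 u) q + classicalPartial 2 (classicalPartial 2 u) q)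

/-- The renormalization `x ↦ v(x)`, `y ↦ v(y)`, `T ↦ v(T)`, read in the arguments of a function of
`(t, x, y)`: for `κ = 1` the time is `t = v(T) / c`, that is `T = c t` with `T` replaced by `v(T)`;
a general `κ` gives the renormalized equation the fractal wave velocity `κ`. -/
def renormalize (c κ : ℝ) (p : Fin 3 → ℝ) : Fin 3 → ℝ :=
  ![κ / c * scalingVar 0 (p 0), scalingVar 1 (p 1), scalingVar 2 (p 2)]

/-- The space-time domain `T > 0`, `(x, y) ∈ D`. -/
def waveCylinder : Set (Fin 3 → ℝ) := {p | 0 < p 0 ∧ (⟨p 1, p 2⟩ : ℂ) ∈ kochDomain}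

/-! ## The series -/

/-- The `(m, n)`-th separated-variable term. -/
def seriesTerm (κ : ℝ) (A : ℕ+ → ℕ+ → ℝ) (p : Fin 3 → ℝ) (k : ℕ+ × ℕ+) : ℝ :=
  A k.1 k.2 *
    Real.cos (Real.pi * κ * √((k.1 : ℝ) ^ 2 + (k.2 : ℝ) ^ 2) * scalingVar 0 (p 0)) *
    Real.sin (Real.pi * (k.1 : ℝ) * scalingVar 1 (p 1)) *
    Real.sin (Real.pi * (k.2 : ℝ) * scalingVar 2 (p 2))

/-- The series `U(T, x, y)`. -/
def seriesSolution (κ : ℝ) (A : ℕ+ → ℕ+ → ℝ) (p : Fin 3 → ℝ) : ℝ :=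
  ∑' k : ℕ+ × ℕ+, seriesTerm κ A p k

/-- The coefficient `4 ∬_D h(x,y) sin(π m v(x)) sin(π n v(y)) dv(x) dv(y)` of initial data `h`. -/
def fourierCoefficient (h : ℂ → ℝ) (m n : ℕ+) : ℝ :=
  4 * ∫ q in {q : ℝ × ℝ | (⟨q.1, q.2⟩ : ℂ) ∈ kochDomain},
    h ⟨q.1, q.2⟩ * Real.sin (Real.pi * (m : ℝ) * scalingVar 1 q.1) *
      Real.sin (Real.pi * (n : ℝ) * scalingVar 2 q.2) ∂(massMeasure.prod massMeasure)

end

end KochWave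

/-!
The theorem rests on one fact of geometric measure theory, `0 < H^{3/2}(Γ) < ∞`; the rest is
calculus in the scaling variables.

*The measure of the curve.* The rotated coordinates `re z + im z` and `re z - im z` turn the eight
similarities into maps of the unit square onto eight cells of the `4 × 4` grid, so the open square
`kochDiamond` witnesses the open set condition. The `8ⁿ` pieces of generation `n` cover `K` and have
size `4⁻ⁿ`, which gives finiteness. For positivity, uniform random addresses push forward to a
probability measure on `K`. The cells of one generation are disjoint, so a set of diameter `4⁻ⁿ`
meets a bounded number of them (`card_wordMap_near_le`) and has mass at most a constant times `8⁻ⁿ`;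
the mass distribution principle concludes (`hausdorffMeasure_kochCurve_pos`).

*The staircases.* `dv` has no atoms, because a vertical line has dimension `1 < 3/2`; it charges
every interval, because the projection of `Γ` is dense in `[-1/3, 4/3]` and every point of `Γ` lies
in arbitrarily small copies of `K`; and it has period `5/3`. Hence every staircase is a
homeomorphism of the line, and it carries `dv` to Lebesgue measure
(`measurePreserving_staircase`). The quarter turn about the centre of the unit square preserves `Γ`
and exchanges the two axes.

*Fractal calculus.* In the variables `v(T)`, `v(x)`, `v(y)` the fractal derivative is the ordinary
one (`hasFractalDerivAt_iff`), so the renormalization is the chain rule for a diagonal linear map.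
The series becomes an ordinary trigonometric series, which the weighted summability of the
coefficients allows to be differentiated twice term by term.

*Coefficients.* The coefficients become Fourier sine coefficients on the unit square. Integration by
parts gives the bounds `|A_{m,n}| ≤ C m⁻ʲ n⁻ˡ` for `j + l = 5`; the geometric means of the pairs
`(3, 2), (4, 1)` and `(2, 3), (1, 4)` suffice for summability (`summable_of_decay`). The initial
value is recovered because the sine products are complete: if all sine coefficients of a continuous
`E` vanish, then `E sin(πx) sin(πy)` is orthogonal to all polynomials in `cos(πx)` and `cos(πy)`,
which are dense by the Stone–Weierstrass theorem (`eq_zero_of_sine_coefficients`).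
-/

namespace KochWave

/-! ### The open set condition for the quadratic Koch curve -/

/-- The open square with diagonal `[0, 1]`. In the rotated coordinates `re z + im z`,
`re z - im z` it is the unit square, and the eight similarities map it onto eight of the sixteen
cells of the `4 × 4` grid, so that it witnesses the open set condition. -/
def kochDiamond : Set ℂ :=
  {z | 0 < z.re + z.im ∧ z.re + z.im < 1 ∧ 0 < z.re - z.im ∧ z.re - z.im < 1}

theorem kochMap_image_kochDiamond_subset (j : Fin 8) : kochMap j '' kochDiamond ⊆ kochDiamond := by
  rintro _ ⟨z, ⟨h1, h2, h3, h4⟩, rfl⟩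
  fin_cases j <;>
    simp [kochDiamond, kochMap, kochVertex, kochDirection, Complex.add_re, Complex.mul_re,
      Complex.normSq] <;>
    norm_num <;> (refine ⟨?_, ?_, ?_, ?_⟩ <;> linarith)

theorem kochMap_image_kochDiamond_disjoint {j k : Fin 8} (hjk : j ≠ k) :
    Disjoint (kochMap j '' kochDiamond) (kochMap k '' kochDiamond) := by
  -- The two tables list the column and the row of the grid cell, in rotated coordinates, onto which
  -- the `j`-th similarity maps the diamond.
  have key : ∀ (j : Fin 8) (z : ℂ), z ∈ kochDiamond →
      ((![0, 1, 2, 2, 1, 1, 2, 3] : Fin 8 → ℤ) j : ℝ) < 4 * ((kochMap j z).re + (kochMap j z).im) ∧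
      4 * ((kochMap j z).re + (kochMap j z).im) <
        ((![0, 1, 2, 2, 1, 1, 2, 3] : Fin 8 → ℤ) j : ℝ) + 1 ∧
      ((![0, 0, 0, 1, 2, 3, 3, 3] : Fin 8 → ℤ) j : ℝ) < 4 * ((kochMap j z).re - (kochMap j z).im) ∧
      4 * ((kochMap j z).re - (kochMap j z).im) <
        ((![0, 0, 0, 1, 2, 3, 3, 3] : Fin 8 → ℤ) j : ℝ) + 1 := by
    rintro j z ⟨h1, h2, h3, h4⟩
    fin_cases j <;>
      simp [kochMap, kochVertex, kochDirection, Complex.add_re, Complex.mul_re,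
        Complex.normSq] <;>
      norm_num <;> (refine ⟨?_, ?_, ?_, ?_⟩ <;> linarith)
  have inj : ∀ j k : Fin 8,
      (![0, 1, 2, 2, 1, 1, 2, 3] : Fin 8 → ℤ) j = (![0, 1, 2, 2, 1, 1, 2, 3] : Fin 8 → ℤ) k →
      (![0, 0, 0, 1, 2, 3, 3, 3] : Fin 8 → ℤ) j = (![0, 0, 0, 1, 2, 3, 3, 3] : Fin 8 → ℤ) k →
      j = k := by decide
  rw [Set.disjoint_left]
  rintro x ⟨z, hz, rfl⟩ ⟨z', hz', h⟩
  obtain ⟨a1, a2, a3, a4⟩ := key j z hz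
  obtain ⟨b1, b2, b3, b4⟩ := key k z' hz'
  rw [h] at b1 b2 b3 b4
  apply hjk
  apply inj
  · have e1 := a1.trans b2
    have e2 := b1.trans a2
    norm_cast at e1 e2
    omega
  · have e1 := a3.trans b4
    have e2 := b3.trans a4
    norm_cast at e1 e2
    omega

theorem norm_kochDirection (j : Fin 8) : ‖kochDirection j‖ = 1 := by
  fin_cases j <;> simp [kochDirection]

theorem kochDirection_ne_zero (j : Fin 8) : kochDirection j ≠ 0 := by
  rw [← norm_ne_zero_iff, norm_kochDirection]; norm_num

theorem norm_kochVertex_le (j : Fin 8) : ‖kochVertex j‖ ≤ 2 := by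
  refine (Complex.norm_le_abs_re_add_abs_im _).trans ?_
  fin_cases j <;> simp [kochVertex, Complex.normSq] <;> norm_num [abs_le]

/-- The composition of `kochMap` along a word `w` of length `n`, first letter outermost. -/
noncomputable def wordMap : (n : ℕ) → (Fin n → Fin 8) → ℂ → ℂ
  | 0, _ => id
  | n + 1, w => fun z => kochMap (w 0) (wordMap n (fun i => w i.succ) z)

/-- Every composition along a word is `z ↦ a + b z` with `|b| = 4⁻ⁿ`. -/
theorem wordMap_eq_affine (n : ℕ) (w : Fin n → Fin 8) :
    ∃ a b : ℂ, ‖b‖ = (1 / 4) ^ n ∧ ∀ z, wordMap n w z = a + b * z := by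
  induction n with
  | zero => exact ⟨0, 1, by simp, fun z => by simp [wordMap]⟩
  | succ n ih =>
    obtain ⟨a, b, hb, h⟩ := ih (fun i => w i.succ)
    refine ⟨kochMap (w 0) a, kochDirection (w 0) / 4 * b, ?_, fun z => ?_⟩
    · rw [norm_mul, norm_div, norm_kochDirection, hb]
      simp [pow_succ]; ring
    · simp only [wordMap, h, kochMap]; ring

theorem dist_wordMap (n : ℕ) (w : Fin n → Fin 8) (z z' : ℂ) :
    dist (wordMap n w z) (wordMap n w z') = (1 / 4) ^ n * dist z z' := by
  obtain ⟨a, b, hb, h⟩ := wordMap_eq_affine n w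
  rw [h, h, dist_add_left, dist_eq_norm, ← mul_sub, norm_mul, hb, dist_eq_norm]

theorem wordMap_surjective (n : ℕ) (w : Fin n → Fin 8) : Function.Surjective (wordMap n w) := by
  obtain ⟨a, b, hb, h⟩ := wordMap_eq_affine n w
  have hb0 : b ≠ 0 := by rw [← norm_ne_zero_iff, hb]; positivity
  intro y
  exact ⟨(y - a) / b, by rw [h]; field_simp; ring⟩

theorem kochMap_injective (j : Fin 8) : Function.Injective (kochMap j) := by
  intro z z' h
  simpa [kochMap, kochDirection_ne_zero] using h

theorem wordMap_image_kochDiamond_subset (n : ℕ) (w : Fin n → Fin 8) :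
    wordMap n w '' kochDiamond ⊆ kochDiamond := by
  induction n with
  | zero => simp [wordMap]
  | succ n ih =>
    rintro _ ⟨z, hz, rfl⟩
    exact kochMap_image_kochDiamond_subset (w 0)
      ⟨_, ih (fun i => w i.succ) ⟨z, hz, rfl⟩, rfl⟩

theorem wordMap_image_kochDiamond_disjoint (n : ℕ) {w w' : Fin n → Fin 8} (h : w ≠ w') :
    Disjoint (wordMap n w '' kochDiamond) (wordMap n w' '' kochDiamond) := by
  induction n with
  | zero => exact absurd (Subsingleton.elim w w') h
  | succ n ih =>
    by_cases h0 : w 0 = w' 0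
    · have ht : (fun i => w (Fin.succ i)) ≠ fun i => w' (Fin.succ i) := by
        intro hc
        apply h
        funext i
        refine Fin.cases h0 (fun i => congrFun hc i) i
      have := ih ht
      rw [Set.disjoint_left] at this ⊢
      rintro _ ⟨z, hz, rfl⟩ ⟨z', hz', he⟩
      simp only [wordMap, h0] at he
      exact this ⟨z, hz, rfl⟩ ⟨z', hz', kochMap_injective _ he⟩
    · refine (kochMap_image_kochDiamond_disjoint h0).mono ?_ ?_
      · rintro _ ⟨z, hz, rfl⟩
        exact ⟨_, wordMap_image_kochDiamond_subset n _ ⟨z, hz, rfl⟩, rfl⟩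
      · rintro _ ⟨z, hz, rfl⟩
        exact ⟨_, wordMap_image_kochDiamond_subset n _ ⟨z, hz, rfl⟩, rfl⟩

theorem ball_subset_kochDiamond : Metric.ball (1 / 2 : ℂ) (1 / 4) ⊆ kochDiamond := by
  intro z hz
  rw [Metric.mem_ball, Complex.dist_eq] at hz
  have h1 := (Complex.abs_re_le_norm (z - 1 / 2)).trans_lt hz
  have h2 := (Complex.abs_im_le_norm (z - 1 / 2)).trans_lt hz
  simp [abs_lt, Complex.normSq] at h1 h2
  norm_num at h1 h2
  refine ⟨?_, ?_, ?_, ?_⟩ <;> linarith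

theorem ball_subset_wordMap_image (n : ℕ) (w : Fin n → Fin 8) :
    Metric.ball (wordMap n w (1 / 2)) (1 / 4 * (1 / 4) ^ n) ⊆ wordMap n w '' kochDiamond := by
  intro y hy
  obtain ⟨z, rfl⟩ := wordMap_surjective n w y
  refine ⟨z, ball_subset_kochDiamond ?_, rfl⟩
  rw [Metric.mem_ball, dist_wordMap, mul_comm] at hy
  exact lt_of_mul_lt_mul_right hy (by positivity)

/-- At most `81` cells of generation `n` have their centre within `2 · 4⁻ⁿ` of a given point:
the discs of radius `4⁻ⁿ⁻¹` about the centres are disjoint, and they lie in a disc of nine times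
that radius. -/
theorem card_wordMap_near_le (n : ℕ) (z₀ : ℂ) (F : Finset (Fin n → Fin 8))
    (hF : ∀ w ∈ F, dist (wordMap n w (1 / 2)) z₀ ≤ 2 * (1 / 4) ^ n) : F.card ≤ 81 := by
  set r : ℝ := 1 / 4 * (1 / 4) ^ n with hr
  have hr0 : 0 < r := by positivity
  have hdisj : (F : Set (Fin n → Fin 8)).PairwiseDisjoint
      fun w => Metric.ball (wordMap n w (1 / 2)) r := by
    intro w _ w' _ hww
    exact (wordMap_image_kochDiamond_disjoint n hww).mono (ball_subset_wordMap_image n w)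
      (ball_subset_wordMap_image n w')
  have hsub : (⋃ w ∈ F, Metric.ball (wordMap n w (1 / 2)) r) ⊆ Metric.ball z₀ (9 * r) := by
    refine Set.iUnion₂_subset fun w hw => Metric.ball_subset_ball' ?_
    have := hF w hw
    have h2 : (2 : ℝ) * (1 / 4) ^ n = 8 * r := by rw [hr]; ring
    linarith
  have hvol := measure_mono (μ := (volume : Measure ℂ)) hsub
  rw [measure_biUnion_finset hdisj (fun w _ => measurableSet_ball)] at hvol
  simp only [Complex.volume_ball, Finset.sum_const, nsmul_eq_mul] at hvol
  have hc : ENNReal.ofReal (9 * r) ^ 2 * (NNReal.pi : ENNReal) =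
      81 * (ENNReal.ofReal r ^ 2 * (NNReal.pi : ENNReal)) := by
    rw [ENNReal.ofReal_mul (by norm_num), mul_pow]
    norm_num [mul_assoc]
  rw [hc, ENNReal.mul_le_mul_iff_left] at hvol
  · exact_mod_cast hvol
  · have : ENNReal.ofReal r ≠ 0 := by simpa using hr0
    have h2 : (NNReal.pi : ENNReal) ≠ 0 := by
      simpa using NNReal.pi_ne_zero
    positivity
  · exact ENNReal.mul_ne_top (by finiteness) (by finiteness)

theorem hutchinson_iterate (n : ℕ) (A : Set ℂ) :
    hutchinson^[n] A = ⋃ w : Fin n → Fin 8, wordMap n w '' A := by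
  induction n with
  | zero => simp [wordMap, Set.iUnion_const]
  | succ n ih =>
    rw [Function.iterate_succ_apply', ih]
    ext y
    simp only [hutchinson, Set.mem_iUnion, Set.mem_image, wordMap]
    constructor
    · rintro ⟨j, _, ⟨w, z, hz, rfl⟩, rfl⟩
      exact ⟨Fin.cons j w, z, hz, by simp⟩
    · rintro ⟨w, z, hz, rfl⟩
      exact ⟨w 0, _, ⟨_, z, hz, rfl⟩, rfl⟩

/-! ### Compactness and finite measure of the curve -/

theorem isCompact_kochBox : IsCompact kochBox := by
  refine Metric.isCompact_of_isClosed_isBounded ?_ ?_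
  · have : kochBox = Complex.re ⁻¹' Set.Icc 0 1 ∩ (fun z => |z.im|) ⁻¹' Set.Iic (1 / 3) := by
      ext z; simp [kochBox, and_assoc]
    rw [this]
    exact (isClosed_Icc.preimage Complex.continuous_re).inter
      (isClosed_Iic.preimage Complex.continuous_im.abs)
  · refine Bornology.IsBounded.subset (Metric.isBounded_closedBall (x := (0 : ℂ)) (r := 2)) ?_
    rintro z ⟨h1, h2, h3⟩
    rw [mem_closedBall_zero_iff]
    refine (Complex.norm_le_abs_re_add_abs_im z).trans ?_
    rw [abs_of_nonneg h1]; linarith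

theorem continuous_wordMap (n : ℕ) (w : Fin n → Fin 8) : Continuous (wordMap n w) := by
  obtain ⟨a, b, -, h⟩ := wordMap_eq_affine n w
  rw [funext h]; fun_prop

theorem kochCurve_subset_kochBox : kochCurve ⊆ kochBox := fun z hz => by
  simpa using Set.mem_iInter.1 hz 0

theorem isCompact_kochCurve : IsCompact kochCurve := by
  refine isCompact_kochBox.of_isClosed_subset ?_ kochCurve_subset_kochBox
  refine isClosed_iInter fun n => ?_
  rw [hutchinson_iterate]
  exact isClosed_iUnion_of_finite fun w =>
    (isCompact_kochBox.image (continuous_wordMap n w)).isClosed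

theorem ediam_wordMap_image_le (n : ℕ) (w : Fin n → Fin 8) (A : Set ℂ) :
    Metric.ediam (wordMap n w '' A) ≤ (1 / 4) ^ n * Metric.ediam A := by
  have : LipschitzWith ((1 / 4) ^ n) (wordMap n w) :=
    LipschitzWith.of_dist_le_mul fun x y => by simp [dist_wordMap]
  simpa [ENNReal.inv_pow] using this.ediam_image_le A

/-- The relation `8 = 4^(3/2)` between the number of pieces and their size. -/
theorem quarter_pow_rpow (n : ℕ) :
    ((1 / 4 : ENNReal) ^ n) ^ (3 / 2 : ℝ) = (1 / 8) ^ n := by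
  have h4 : (1 / 4 : ENNReal) ^ (3 / 2 : ℝ) = 1 / 8 := by
    rw [one_div, ENNReal.inv_rpow, show (4 : ENNReal) = 2 ^ (2 : ℝ) by norm_num,
      ← ENNReal.rpow_mul]
    norm_num
  rw [← ENNReal.rpow_natCast, ← ENNReal.rpow_mul, mul_comm, ENNReal.rpow_mul, h4,
    ENNReal.rpow_natCast]

theorem hausdorffMeasure_kochCurve_lt_top :
    Measure.hausdorffMeasure (3 / 2 : ℝ) kochCurve < ⊤ := by
  set d := Metric.ediam kochBox
  have hd : d ≠ ⊤ := isCompact_kochBox.isBounded.ediam_ne_top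
  have h := Measure.hausdorffMeasure_le_liminf_sum (3 / 2 : ℝ) kochCurve (l := atTop)
    (fun n : ℕ => (1 / 4 : ENNReal) ^ n * d)
    (by
      have := ENNReal.Tendsto.mul_const (b := d)
        (ENNReal.tendsto_pow_atTop_nhds_zero_of_lt_one (r := 1 / 4) (by
          rw [one_div, ENNReal.inv_lt_one]; norm_num)) (Or.inr hd)
      simpa using this)
    (fun n (w : Fin n → Fin 8) => wordMap n w '' kochBox)
    (Eventually.of_forall fun n w => ediam_wordMap_image_le n w _)
    (Eventually.of_forall fun n => by
      rw [← hutchinson_iterate]; exact Set.iInter_subset _ n)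
  refine lt_of_le_of_lt h (lt_of_le_of_lt (b := d ^ (3 / 2 : ℝ)) ?_
    (ENNReal.rpow_lt_top_of_nonneg (by norm_num) hd))
  refine Filter.liminf_le_of_le (by isBoundedDefault) fun b hb => ?_
  obtain ⟨n, hn⟩ := hb.exists
  refine hn.trans ?_
  refine (Finset.sum_le_sum fun w _ => ENNReal.rpow_le_rpow (ediam_wordMap_image_le n w _)
    (by norm_num)).trans ?_
  simp only [Finset.sum_const, Finset.card_univ, Fintype.card_fun, Fintype.card_fin, nsmul_eq_mul]
  rw [ENNReal.mul_rpow_of_nonneg _ _ (by norm_num), ← mul_assoc]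
  rw [quarter_pow_rpow]
  push_cast
  rw [← mul_pow, one_div, ENNReal.mul_inv_cancel (by norm_num) (by norm_num)]
  simp [d]

/-! ### Coding by words and the mass distribution principle -/

/-- The point of the curve with address `ω`. -/
noncomputable def code (ω : ℕ → Fin 8) : ℂ :=
  ∑' k, (∏ i ∈ Finset.range k, kochDirection (ω i) / 4) * kochVertex (ω k)

theorem summable_code (ω : ℕ → Fin 8) :
    Summable fun k => (∏ i ∈ Finset.range k, kochDirection (ω i) / 4) * kochVertex (ω k) := by
  refine Summable.of_norm_bounded (g := fun k => (1 / 4 : ℝ) ^ k * 2)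
    ((summable_geometric_of_lt_one (by norm_num) (by norm_num)).mul_right 2) fun k => ?_
  rw [norm_mul, norm_prod]
  simp only [norm_div, norm_kochDirection, Complex.norm_ofNat, Finset.prod_const,
    Finset.card_range]
  gcongr
  exact norm_kochVertex_le _

theorem code_eq_kochMap (ω : ℕ → Fin 8) : code ω = kochMap (ω 0) (code fun i => ω (i + 1)) := by
  rw [code, (summable_code ω).tsum_eq_zero_add, kochMap, code, ← tsum_mul_left]
  simp only [Finset.range_zero, Finset.prod_empty, one_mul, Finset.prod_range_succ']
  congr 2
  ext k; ring

theorem code_eq_wordMap (n : ℕ) (ω : ℕ → Fin 8) :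
    code ω = wordMap n (fun i => ω i) (code fun i => ω (i + n)) := by
  induction n generalizing ω with
  | zero => simp [wordMap]
  | succ n ih =>
    rw [code_eq_kochMap, ih]
    simp [wordMap, add_assoc]

theorem wordMap_image_kochBox_subset (n : ℕ) (w : Fin n → Fin 8) :
    wordMap n w '' kochBox ⊆ kochBox := by
  induction n with
  | zero => simp [wordMap]
  | succ n ih =>
    rintro _ ⟨z, hz, rfl⟩
    exact hutchinson_kochBox_subset (Set.mem_iUnion.2 ⟨w 0, _, ih _ ⟨z, hz, rfl⟩, rfl⟩)

theorem code_mem_kochBox (ω : ℕ → Fin 8) : code ω ∈ kochBox := by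
  have hpart : ∀ (n : ℕ) (ω : ℕ → Fin 8), ∑ k ∈ Finset.range n,
      (∏ i ∈ Finset.range k, kochDirection (ω i) / 4) * kochVertex (ω k) =
        wordMap n (fun i => ω i) 0 := by
    intro n
    induction n with
    | zero => simp [wordMap]
    | succ n ih =>
      intro ω
      rw [Finset.sum_range_succ']
      simp only [Finset.prod_range_succ', wordMap, kochMap, Fin.val_succ, Fin.val_zero,
        Finset.range_zero, Finset.prod_empty, one_mul]
      rw [← ih fun i => ω (i + 1), Finset.mul_sum, add_comm]
      congr 1
      exact Finset.sum_congr rfl fun k _ => by ring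
  refine isCompact_kochBox.isClosed.mem_of_tendsto (summable_code ω).hasSum.tendsto_sum_nat
    (Eventually.of_forall fun n => ?_)
  rw [hpart]
  exact wordMap_image_kochBox_subset n _ ⟨0, by simp [kochBox], rfl⟩

theorem code_mem_kochCurve (ω : ℕ → Fin 8) : code ω ∈ kochCurve := by
  refine Set.mem_iInter.2 fun n => ?_
  rw [hutchinson_iterate, code_eq_wordMap n]
  exact Set.mem_iUnion.2 ⟨_, _, code_mem_kochBox _, rfl⟩

theorem measurable_code : Measurable code := by
  refine measurable_of_tendsto_metrizable (f := fun n (ω : ℕ → Fin 8) => ∑ k ∈ Finset.range n,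
    (∏ i ∈ Finset.range k, kochDirection (ω i) / 4) * kochVertex (ω k)) (fun n => ?_)
    (tendsto_pi_nhds.2 fun ω => (summable_code ω).hasSum.tendsto_sum_nat)
  have hd : ∀ i : ℕ, Measurable fun ω : ℕ → Fin 8 => kochDirection (ω i) := fun i =>
    (measurable_of_countable kochDirection).comp (measurable_pi_apply i)
  have hv : ∀ i : ℕ, Measurable fun ω : ℕ → Fin 8 => kochVertex (ω i) := fun i =>
    (measurable_of_countable kochVertex).comp (measurable_pi_apply i)
  fun_prop

/-- Bernoulli measure: the letters of the address are independent and uniform. -/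
noncomputable def addressMeasure : Measure (ℕ → Fin 8) :=
  Measure.infinitePi fun _ => (PMF.uniformOfFintype (Fin 8)).toMeasure

instance : IsProbabilityMeasure addressMeasure := by
  unfold addressMeasure; infer_instance

theorem addressMeasure_cylinder (n : ℕ) (w : Fin n → Fin 8) :
    addressMeasure {ω | (fun i : Fin n => ω i) = w} = (1 / 8) ^ n := by
  have : {ω : ℕ → Fin 8 | (fun i : Fin n => ω i) = w} = Set.pi (Finset.range n : Set ℕ)
      (fun i => if h : i < n then {w ⟨i, h⟩} else ∅) := by
    ext ω
    simp only [Set.mem_ofPred_eq, Set.mem_pi, Finset.coe_range, Set.mem_Iio, funext_iff]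
    constructor
    · intro h i hi
      simpa [hi] using h ⟨i, hi⟩
    · intro h i
      simpa using h i i.2
  rw [this, addressMeasure, Measure.infinitePi_pi _ (fun i _ => MeasurableSet.of_discrete)]
  rw [Finset.prod_congr rfl (g := fun _ => (1 / 8 : ENNReal))]
  · simp
  · intro i hi
    rw [Finset.mem_range] at hi
    rw [dif_pos hi, PMF.toMeasure_apply_singleton _ _ (MeasurableSet.singleton _)]
    simp

/-- A set of diameter at most `4⁻ⁿ` meets at most `81` cells of generation `n`. -/
theorem map_code_le_of_ediam_le (n : ℕ) (E : Set ℂ) (hE : Metric.ediam E ≤ (1 / 4) ^ n) :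
    addressMeasure.map code E ≤ 81 * (1 / 8) ^ n := by
  refine (measure_mono subset_closure).trans ?_
  rw [← Metric.ediam_closure] at hE
  rw [Measure.map_apply measurable_code isClosed_closure.measurableSet]
  rcases (code ⁻¹' closure E).eq_empty_or_nonempty with h0 | ⟨ω₀, h0⟩
  · simp [h0]
  classical
  set F : Finset (Fin n → Fin 8) := {w | dist (wordMap n w (1 / 2)) (code ω₀) ≤ 2 * (1 / 4) ^ n}
  have hsub : code ⁻¹' closure E ⊆ ⋃ w ∈ F, {ω | (fun i : Fin n => ω i) = w} := by
    intro ω hω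
    simp only [Set.mem_iUnion, Set.mem_ofPred_eq, exists_prop, F, Finset.mem_filter,
      Finset.mem_univ, true_and]
    refine ⟨_, ?_, rfl⟩
    have h1 : dist (code ω) (code ω₀) ≤ (1 / 4) ^ n := by
      have := (Metric.edist_le_ediam_of_mem (Set.mem_preimage.1 hω) (Set.mem_preimage.1 h0)).trans hE
      rw [edist_dist] at this
      have h2 : ((1 / 4 : ENNReal)) ^ n = ENNReal.ofReal ((1 / 4) ^ n) := by
        rw [ENNReal.ofReal_pow (by norm_num), ENNReal.ofReal_div_of_pos (by norm_num)]
        norm_num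
      rw [h2] at this
      exact (ENNReal.ofReal_le_ofReal_iff (by positivity)).1 this
    have h2 : dist (wordMap n (fun i => ω i) (1 / 2)) (code ω) ≤ (1 / 4) ^ n := by
      rw [code_eq_wordMap n ω, dist_wordMap]
      obtain ⟨a1, a2, a3⟩ := code_mem_kochBox fun i => ω (i + n)
      have : dist (1 / 2 : ℂ) (code fun i => ω (i + n)) ≤ 1 := by
        rw [Complex.dist_eq]
        refine (Complex.norm_le_abs_re_add_abs_im _).trans ?_
        have : |(1 / 2 - code fun i => ω (i + n)).re| ≤ 1 / 2 := by
          rw [abs_le]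
          simp [Complex.normSq]
          constructor <;> linarith
        have h3 : |(1 / 2 - code fun i => ω (i + n)).im| ≤ 1 / 3 := by
          simpa using a3
        linarith
      exact mul_le_of_le_one_right (by positivity) this
    linarith [dist_triangle (wordMap n (fun i => ω i) (1 / 2)) (code ω) (code ω₀)]
  refine (measure_mono hsub).trans ((measure_biUnion_finset_le _ _).trans ?_)
  simp only [addressMeasure_cylinder, Finset.sum_const, nsmul_eq_mul]
  gcongr
  exact_mod_cast card_wordMap_near_le n (code ω₀) F (by simp [F])

/-- The mass distribution estimate. The constant is `81 · 8`: a diameter between `4⁻ⁿ⁻¹` and `4⁻ⁿ`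
is estimated at generation `n`. -/
theorem map_code_le_ediam_rpow (E : Set ℂ) (hE : Metric.ediam E ≤ 1) :
    addressMeasure.map code E ≤ 648 * Metric.ediam E ^ (3 / 2 : ℝ) := by
  have h14 : (1 / 4 : ENNReal) < 1 := by rw [one_div, ENNReal.inv_lt_one]; norm_num
  have h18 : (1 / 8 : ENNReal) < 1 := by rw [one_div, ENNReal.inv_lt_one]; norm_num
  rcases eq_or_ne (Metric.ediam E) 0 with h0 | h0
  · have : Tendsto (fun n : ℕ => 81 * (1 / 8 : ENNReal) ^ n) atTop (𝓝 (81 * 0)) :=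
      ENNReal.Tendsto.const_mul (ENNReal.tendsto_pow_atTop_nhds_zero_of_lt_one h18)
        (Or.inr (by norm_num))
    have h := ge_of_tendsto' this fun n => map_code_le_of_ediam_le n E (by simp [h0])
    exact h.trans (by simp)
  · -- the largest generation `n` with `diam E ≤ 4⁻ⁿ`
    have hex : ∃ n : ℕ, (1 / 4 : ENNReal) ^ n < Metric.ediam E :=
      ((ENNReal.tendsto_pow_atTop_nhds_zero_of_lt_one h14).eventually_lt_const
        (pos_iff_ne_zero.2 h0)).exists
    classical
    obtain ⟨n, hn⟩ : ∃ n, Nat.find hex = n + 1 := by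
      refine Nat.exists_eq_succ_of_ne_zero fun h => ?_
      have := Nat.find_spec hex
      rw [h, pow_zero] at this
      exact absurd hE (not_le.2 this)
    have h1 : Metric.ediam E ≤ (1 / 4) ^ n :=
      not_lt.1 (Nat.find_min hex (m := n) (by omega))
    have h2 : (1 / 4 : ENNReal) ^ (n + 1) < Metric.ediam E := hn ▸ Nat.find_spec hex
    refine (map_code_le_of_ediam_le n E h1).trans ?_
    calc (81 : ENNReal) * (1 / 8) ^ n = 648 * (1 / 8) ^ (n + 1) := by
          rw [pow_succ', ← mul_assoc, show (648 : ENNReal) = 81 * 8 by norm_num, one_div,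
            mul_assoc 81, ENNReal.mul_inv_cancel (by norm_num) (by norm_num), mul_one]
      _ ≤ _ := by
          rw [← quarter_pow_rpow]
          gcongr

theorem hausdorffMeasure_kochCurve_pos :
    0 < Measure.hausdorffMeasure (3 / 2 : ℝ) kochCurve := by
  have hle : (648 : ENNReal)⁻¹ • addressMeasure.map code ≤
      Measure.hausdorffMeasure (3 / 2 : ℝ) := by
    refine Measure.le_hausdorffMeasure _ _ 1 one_pos fun E hE => ?_
    rw [Measure.smul_apply, smul_eq_mul]
    refine (mul_le_mul_right (map_code_le_ediam_rpow E hE) _).trans ?_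
    rw [← mul_assoc, ENNReal.inv_mul_cancel (by norm_num) (by norm_num), one_mul]
  refine lt_of_lt_of_le ?_ (hle kochCurve)
  rw [Measure.smul_apply, smul_eq_mul, Measure.map_apply measurable_code
    isCompact_kochCurve.isClosed.measurableSet]
  have : code ⁻¹' kochCurve = Set.univ := Set.eq_univ_of_forall code_mem_kochCurve
  rw [this, measure_univ]
  simp

/-! ### The closed curve and its projected mass -/

/-- The quarter turn about the centre `(1 + i) / 2` of the unit square. -/
noncomputable def quarterTurn (z : ℂ) : ℂ := 1 + Complex.I * z

theorem isometry_affine {b : ℂ} (hb : ‖b‖ = 1) (a : ℂ) : Isometry fun z : ℂ => a + b * z :=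
  Isometry.of_dist_eq fun z z' => by
    rw [dist_add_left, dist_eq_norm, ← mul_sub, norm_mul, hb, one_mul, dist_eq_norm]

/-- The curve `Γ` is the union of four isometric copies of `K`. -/
theorem kochBoundary_eq_union : kochBoundary = kochCurve ∪ quarterTurn '' kochCurve ∪
    (fun z => (1 + Complex.I) + (-1) * z) '' kochCurve ∪
    (fun z => Complex.I + (-Complex.I) * z) '' kochCurve := by
  have h1 : (fun z : ℂ => 1 + Complex.I * z) = quarterTurn := rfl
  have h2 : (fun z : ℂ => 1 + Complex.I - z) = fun z => (1 + Complex.I) + (-1) * z := by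
    ext z; ring
  have h3 : (fun z : ℂ => Complex.I - Complex.I * z) = fun z => Complex.I + (-Complex.I) * z := by
    ext z; ring
  rw [kochBoundary, h1, h2, h3]

theorem quarterTurn_surjective : Function.Surjective quarterTurn := fun w =>
  ⟨-Complex.I * (w - 1), by simp [quarterTurn, ← mul_assoc]⟩

theorem isometry_quarterTurn : Isometry quarterTurn := isometry_affine Complex.norm_I 1

theorem quarterTurn_image_kochBoundary : quarterTurn '' kochBoundary = kochBoundary := by
  have h1 : ∀ z : ℂ, quarterTurn (quarterTurn z) = 1 + Complex.I + -1 * z := fun z => by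
    simp only [quarterTurn]; linear_combination z * Complex.I_sq
  have h2 : ∀ z : ℂ, quarterTurn (1 + Complex.I + -1 * z) = Complex.I + -Complex.I * z :=
    fun z => by simp only [quarterTurn]; linear_combination Complex.I_sq
  have h3 : ∀ z : ℂ, quarterTurn (Complex.I + -Complex.I * z) = z := fun z => by
    simp only [quarterTurn]; linear_combination (1 - z) * Complex.I_sq
  rw [kochBoundary_eq_union]
  simp only [Set.image_union, Set.image_image, h1, h2, h3, Set.image_id']
  ext z; simp only [Set.mem_union]; tauto

theorem quarterTurn_preimage_kochBoundary : quarterTurn ⁻¹' kochBoundary = kochBoundary := by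
  conv_lhs => rw [← quarterTurn_image_kochBoundary]
  exact Set.preimage_image_eq _ isometry_quarterTurn.injective

/-- The quarter turn exchanges the two projections of `Γ`. -/
theorem hausdorffMeasure_re_eq_im (B : Set ℝ) :
    Measure.hausdorffMeasure (3 / 2 : ℝ) (kochBoundary ∩ Complex.re ⁻¹' B) =
      Measure.hausdorffMeasure (3 / 2 : ℝ) (kochBoundary ∩ Complex.im ⁻¹' B) := by
  have h : kochBoundary ∩ Complex.re ⁻¹' B =
      quarterTurn ⁻¹' (kochBoundary ∩ Complex.im ⁻¹' B) := by
    rw [Set.preimage_inter, quarterTurn_preimage_kochBoundary]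
    congr 1
    ext z; simp [quarterTurn]
  rw [h, ← isometry_quarterTurn.hausdorffMeasure_image (Or.inl (by norm_num)),
    Set.image_preimage_eq _ quarterTurn_surjective]

theorem isCompact_kochBoundary : IsCompact kochBoundary := by
  rw [kochBoundary_eq_union]
  refine ((isCompact_kochCurve.union (isCompact_kochCurve.image ?_)).union
    (isCompact_kochCurve.image ?_)).union (isCompact_kochCurve.image ?_)
  · exact isometry_quarterTurn.continuous
  · fun_prop
  · fun_prop

theorem kochBoundary_subset_square {z : ℂ} (hz : z ∈ kochBoundary) :
    (-1 / 3 ≤ z.re ∧ z.re ≤ 4 / 3) ∧ (-1 / 3 ≤ z.im ∧ z.im ≤ 4 / 3) := by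
  have hK : ∀ z ∈ kochCurve, 0 ≤ z.re ∧ z.re ≤ 1 ∧ -(1 / 3) ≤ z.im ∧ z.im ≤ 1 / 3 := fun z hz => by
    obtain ⟨h1, h2, h3⟩ := kochCurve_subset_kochBox hz
    exact ⟨h1, h2, abs_le.1 h3⟩
  rw [kochBoundary_eq_union] at hz
  rcases hz with ((hz | ⟨z, hz, rfl⟩) | ⟨z, hz, rfl⟩) | ⟨z, hz, rfl⟩ <;>
    obtain ⟨h1, h2, h3, h4⟩ := hK z hz <;>
    refine ⟨⟨?_, ?_⟩, ⟨?_, ?_⟩⟩ <;> (try simp [quarterTurn]) <;> linarith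

theorem hausdorffMeasure_kochBoundary_lt_top :
    Measure.hausdorffMeasure (3 / 2 : ℝ) kochBoundary < ⊤ := by
  have h : ∀ {f : ℂ → ℂ}, Isometry f →
      Measure.hausdorffMeasure (3 / 2 : ℝ) (f '' kochCurve) < ⊤ := fun hf => by
    rw [hf.hausdorffMeasure_image (Or.inl (by norm_num))]
    exact hausdorffMeasure_kochCurve_lt_top
  rw [kochBoundary_eq_union]
  refine measure_union_lt_top (measure_union_lt_top (measure_union_lt_top
    hausdorffMeasure_kochCurve_lt_top (h isometry_quarterTurn)) (h (isometry_affine ?_ _)))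
    (h (isometry_affine ?_ _)) <;> simp

theorem kochMap_image_kochCurve_subset (j : Fin 8) : kochMap j '' kochCurve ⊆ kochCurve := by
  rintro _ ⟨z, hz, rfl⟩
  refine Set.mem_iInter.2 fun n => ?_
  cases n with
  | zero =>
    exact hutchinson_kochBox_subset (Set.mem_iUnion.2
      ⟨j, z, kochCurve_subset_kochBox hz, rfl⟩)
  | succ n =>
    rw [Function.iterate_succ_apply']
    exact Set.mem_iUnion.2 ⟨j, z, Set.mem_iInter.1 hz n, rfl⟩

theorem wordMap_image_kochCurve_subset (n : ℕ) (w : Fin n → Fin 8) :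
    wordMap n w '' kochCurve ⊆ kochCurve := by
  induction n with
  | zero => simp [wordMap]
  | succ n ih =>
    rintro _ ⟨z, hz, rfl⟩
    exact kochMap_image_kochCurve_subset (w 0) ⟨_, ih _ ⟨z, hz, rfl⟩, rfl⟩

theorem hausdorffMeasure_wordMap_image_pos (n : ℕ) (w : Fin n → Fin 8) :
    0 < Measure.hausdorffMeasure (3 / 2 : ℝ) (wordMap n w '' kochCurve) := by
  have h : AntilipschitzWith (4 ^ n) (wordMap n w) := AntilipschitzWith.of_le_mul_dist
    fun x y => by
      rw [dist_wordMap, ← mul_assoc]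
      push_cast
      rw [← mul_pow]; norm_num
  have := h.le_hausdorffMeasure_image (d := 3 / 2) (by norm_num) kochCurve
  by_contra h0
  rw [not_lt, nonpos_iff_eq_zero] at h0
  rw [h0, mul_zero] at this
  exact absurd hausdorffMeasure_kochCurve_pos (not_lt.2 this)

theorem hausdorffMeasure_kochCurve_inter_pos {U : Set ℂ} (hU : IsOpen U)
    (h : (kochCurve ∩ U).Nonempty) :
    0 < Measure.hausdorffMeasure (3 / 2 : ℝ) (kochCurve ∩ U) := by
  obtain ⟨z, hz, hzU⟩ := h
  obtain ⟨ε, hε, hball⟩ := Metric.isOpen_iff.1 hU z hzU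
  obtain ⟨n, hn⟩ := exists_pow_lt_of_lt_one (show 0 < ε / 2 by positivity)
    (show (1 / 4 : ℝ) < 1 by norm_num)
  have hzn := Set.mem_iInter.1 hz n
  rw [hutchinson_iterate] at hzn
  obtain ⟨w, z', hz', rfl⟩ := Set.mem_iUnion.1 hzn
  refine (hausdorffMeasure_wordMap_image_pos n w).trans_le (measure_mono
    (Set.subset_inter (wordMap_image_kochCurve_subset n w) ?_))
  rintro _ ⟨y, hy, rfl⟩
  apply hball
  rw [Metric.mem_ball, dist_wordMap]
  obtain ⟨a1, a2, a3⟩ := kochCurve_subset_kochBox hy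
  obtain ⟨b1, b2, b3⟩ := hz'
  rw [abs_le] at a3 b3
  have h1 : dist y z' ≤ 2 := by
    rw [Complex.dist_eq]
    refine (Complex.norm_le_abs_re_add_abs_im _).trans ?_
    have e1 : |(y - z').re| ≤ 1 := by rw [Complex.sub_re, abs_le]; constructor <;> linarith
    have e2 : |(y - z').im| ≤ 1 := by rw [Complex.sub_im, abs_le]; constructor <;> linarith
    linarith
  calc (1 / 4 : ℝ) ^ n * dist y z' ≤ (1 / 4 : ℝ) ^ n * 2 := by gcongr
    _ < ε := by linarith

theorem hausdorffMeasure_kochBoundary_inter_pos {U : Set ℂ} (hU : IsOpen U)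
    (h : (kochBoundary ∩ U).Nonempty) :
    0 < Measure.hausdorffMeasure (3 / 2 : ℝ) (kochBoundary ∩ U) := by
  have key : ∀ {f : ℂ → ℂ}, Isometry f → f '' kochCurve ⊆ kochBoundary →
      (f '' kochCurve ∩ U).Nonempty →
      0 < Measure.hausdorffMeasure (3 / 2 : ℝ) (kochBoundary ∩ U) := by
    rintro f hf hsub ⟨_, ⟨z, hz, rfl⟩, hzU⟩
    have h1 := hausdorffMeasure_kochCurve_inter_pos (hU.preimage hf.continuous) ⟨z, hz, hzU⟩
    rw [← hf.hausdorffMeasure_image (Or.inl (by norm_num))] at h1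
    refine h1.trans_le (measure_mono ?_)
    rintro _ ⟨y, hy, rfl⟩
    exact ⟨hsub ⟨y, hy.1, rfl⟩, hy.2⟩
  obtain ⟨z, hz, hzU⟩ := h
  have hΓ := kochBoundary_eq_union
  rw [hΓ] at hz
  rcases hz with ((hz | hz) | hz) | hz
  · refine key isometry_id ?_ ⟨z, by simpa using hz, hzU⟩
    rw [hΓ]; intro y hy; simp at hy; tauto
  · refine key isometry_quarterTurn ?_ ⟨z, hz, hzU⟩
    rw [hΓ]; intro y hy; simp only [Set.mem_union]; tauto
  · refine key (isometry_affine (by simp) _) ?_ ⟨z, hz, hzU⟩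
    rw [hΓ]; intro y hy; simp only [Set.mem_union]; tauto
  · refine key (isometry_affine (by simp) _) ?_ ⟨z, hz, hzU⟩
    rw [hΓ]; intro y hy; simp only [Set.mem_union]; tauto

theorem hausdorffMeasure_kochBoundary_pos :
    0 < Measure.hausdorffMeasure (3 / 2 : ℝ) kochBoundary := by
  refine hausdorffMeasure_kochCurve_pos.trans_le (measure_mono ?_)
  rw [kochBoundary_eq_union]; intro y hy; simp only [Set.mem_union]; tauto

/-- The real parts of `K` are dense in `[0, 1]`: the pieces `0, 2, 5, 7` of `K` project onto the
four quarters. -/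
theorem exists_kochCurve_re_near (n : ℕ) {x : ℝ} (h0 : 0 ≤ x) (h1 : x ≤ 1) :
    ∃ z ∈ kochCurve, |x - z.re| ≤ (1 / 4) ^ n := by
  induction n generalizing x with
  | zero =>
    refine ⟨_, code_mem_kochCurve fun _ => 0, ?_⟩
    obtain ⟨a1, a2, -⟩ := code_mem_kochBox fun _ => 0
    rw [pow_zero, abs_le]; constructor <;> linarith
  | succ n ih =>
    have key : ∀ (j : Fin 8) (k : ℝ), (∀ z, (kochMap j z).re = (k + z.re) / 4) → 0 ≤ 4 * x - k →
        4 * x - k ≤ 1 → ∃ z ∈ kochCurve, |x - z.re| ≤ (1 / 4) ^ (n + 1) := by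
      intro j k hj e0 e1
      obtain ⟨z, hz, hd⟩ := ih e0 e1
      refine ⟨kochMap j z, kochMap_image_kochCurve_subset j ⟨z, hz, rfl⟩, ?_⟩
      rw [hj, pow_succ, show x - (k + z.re) / 4 = (4 * x - k - z.re) * (1 / 4) by ring, abs_mul,
        abs_of_pos (show (0 : ℝ) < 1 / 4 by norm_num)]
      gcongr
    rcases le_total x (1 / 4) with h | h
    · exact key 0 0 (fun z => by simp [kochMap, kochVertex, kochDirection]; ring) (by linarith)
        (by linarith)
    rcases le_total x (1 / 2) with h' | h'
    · exact key 2 1 (fun z => by simp [kochMap, kochVertex, kochDirection]; ring) (by linarith)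
        (by linarith)
    rcases le_total x (3 / 4) with h'' | h''
    · exact key 5 2 (fun z => by simp [kochMap, kochVertex, kochDirection]; ring) (by linarith)
        (by linarith)
    · exact key 7 3 (fun z => by simp [kochMap, kochVertex, kochDirection, Complex.normSq]; ring)
        (by linarith) (by linarith)

/-- The imaginary parts of `K` are dense in `[-1/3, 0]`: piece `4` projects onto `[-1/4, 0]`, and
piece `5` carries this dense set on to `-1/3`. -/
theorem exists_kochCurve_im_near (n : ℕ) {x : ℝ} (h0 : -1 / 3 ≤ x) (h1 : x ≤ 0) :
    ∃ z ∈ kochCurve, |x - z.im| ≤ (1 / 4) ^ n := by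
  induction n generalizing x with
  | zero =>
    refine ⟨_, code_mem_kochCurve fun _ => 0, ?_⟩
    obtain ⟨-, -, a3⟩ := code_mem_kochBox fun _ => 0
    rw [abs_le] at a3
    rw [pow_zero, abs_le]; constructor <;> linarith
  | succ n ih =>
    rcases le_total (-1 / 4) x with h | h
    · obtain ⟨z, hz, hd⟩ := exists_kochCurve_re_near n (x := -4 * x) (by linarith) (by linarith)
      refine ⟨kochMap 4 z, kochMap_image_kochCurve_subset 4 ⟨z, hz, rfl⟩, ?_⟩
      have : x - (kochMap 4 z).im = -((-4 * x - z.re) * (1 / 4)) := by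
        simp [kochMap, kochVertex, kochDirection, Complex.normSq]; ring
      rw [this, abs_neg, abs_mul, pow_succ, abs_of_pos (show (0 : ℝ) < 1 / 4 by norm_num)]
      gcongr
    · obtain ⟨z, hz, hd⟩ := ih (x := 4 * x + 1) (by linarith) (by linarith)
      refine ⟨kochMap 5 z, kochMap_image_kochCurve_subset 5 ⟨z, hz, rfl⟩, ?_⟩
      have : x - (kochMap 5 z).im = (4 * x + 1 - z.im) * (1 / 4) := by
        simp [kochMap, kochVertex, kochDirection, Complex.normSq]; ring
      rw [this, abs_mul, pow_succ, abs_of_pos (show (0 : ℝ) < 1 / 4 by norm_num)]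
      gcongr

theorem exists_kochBoundary_re_mem {a b : ℝ} (ha : -1 / 3 ≤ a) (hab : a < b) (hb : b ≤ 4 / 3) :
    ∃ z ∈ kochBoundary, z.re ∈ Set.Ioo a b := by
  obtain ⟨n, hn⟩ := exists_pow_lt_of_lt_one (show 0 < (b - a) / 2 by linarith)
    (show (1 / 4 : ℝ) < 1 by norm_num)
  have hm : ∀ y : ℝ, |(a + b) / 2 - y| ≤ (1 / 4) ^ n → y ∈ Set.Ioo a b := fun y hy => by
    rw [abs_le] at hy
    constructor <;> linarith
  rw [kochBoundary_eq_union]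
  rcases le_total ((a + b) / 2) 0 with h | h
  · obtain ⟨z, hz, hd⟩ := exists_kochCurve_im_near n (x := (a + b) / 2) (by linarith) h
    exact ⟨_, Or.inr ⟨z, hz, rfl⟩, hm _ (by simpa using hd)⟩
  rcases le_total ((a + b) / 2) 1 with h' | h'
  · obtain ⟨z, hz, hd⟩ := exists_kochCurve_re_near n h h'
    exact ⟨z, Or.inl (Or.inl (Or.inl hz)), hm _ hd⟩
  · obtain ⟨z, hz, hd⟩ := exists_kochCurve_im_near n (x := 1 - (a + b) / 2) (by linarith)
      (by linarith)
    refine ⟨_, Or.inl (Or.inl (Or.inr ⟨z, hz, rfl⟩)), hm _ ?_⟩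
    have : (a + b) / 2 - (quarterTurn z).re = -(1 - (a + b) / 2 - z.im) := by
      simp [quarterTurn]; ring
    rw [this, abs_neg]; exact hd

/-! ### The staircase functions -/

theorem massMeasure_apply {B : Set ℝ} (hB : MeasurableSet B) :
    massMeasure B = (Measure.hausdorffMeasure (3 / 2 : ℝ) kochBoundary)⁻¹ *
      Measure.hausdorffMeasure (3 / 2 : ℝ) (Complex.re ⁻¹' B ∩ kochChain) := by
  have hB' := Complex.measurable_re hB
  rw [massMeasure, Measure.smul_apply, Measure.map_apply Complex.measurable_re hB,
    Measure.restrict_apply hB', smul_eq_mul]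

theorem hausdorffMeasure_vertical_line (x : ℝ) :
    Measure.hausdorffMeasure (3 / 2 : ℝ) (Complex.re ⁻¹' {x}) = 0 := by
  have hi : Isometry fun t : ℝ => (⟨x, t⟩ : ℂ) := Isometry.of_dist_eq fun s t =>
    Complex.dist_of_re_eq (z := ⟨x, s⟩) (w := ⟨x, t⟩) rfl
  have h : Complex.re ⁻¹' {x} = (fun t : ℝ => (⟨x, t⟩ : ℂ)) '' Set.univ := by
    ext z
    constructor
    · intro hz; exact ⟨z.im, trivial, by rw [← show z.re = x from hz]⟩
    · rintro ⟨t, -, rfl⟩; rfl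
  rw [h, hi.hausdorffMeasure_image (Or.inl (by norm_num))]
  have := hausdorffMeasure_of_dimH_lt (s := (Set.univ : Set ℝ)) (d := 3 / 2) (by
    rw [Real.dimH_univ]; norm_cast
    rw [← NNReal.coe_lt_coe]; norm_num)
  simpa using this

instance : NullSingletonClass massMeasure := ⟨fun x => by
  rw [massMeasure_apply (measurableSet_singleton x)]
  rw [measure_mono_null Set.inter_subset_left (hausdorffMeasure_vertical_line x), mul_zero]⟩

theorem re_preimage_inter_kochChain {B : Set ℝ} (hB : B ⊆ Set.Ioo (-1 / 3) (4 / 3)) :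
    Complex.re ⁻¹' B ∩ kochChain = kochBoundary ∩ Complex.re ⁻¹' B := by
  ext z
  constructor
  · rintro ⟨hz, hc⟩
    obtain ⟨k, y, hy, rfl⟩ := Set.mem_iUnion.1 hc
    obtain ⟨⟨h1, h2⟩, -⟩ := kochBoundary_subset_square hy
    obtain ⟨h3, h4⟩ := hB hz
    simp only [Complex.add_re, Complex.ofReal_re] at h3 h4
    have hk : k = 0 := by
      have e1 : (k : ℝ) < 1 := by linarith
      have e2 : (-1 : ℝ) < k := by linarith
      have e1' : k < 1 := by exact_mod_cast e1
      have e2' : -1 < k := by exact_mod_cast e2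
      omega
    subst hk
    simp only [Int.cast_zero, zero_mul, Complex.ofReal_zero, add_zero] at hz ⊢
    exact ⟨hy, hz⟩
  · rintro ⟨hz, hc⟩
    exact ⟨hc, Set.mem_iUnion.2 ⟨0, z, hz, by simp⟩⟩

theorem massMeasure_Ioo_period : massMeasure (Set.Ioo (-1 / 3) (4 / 3)) = 1 := by
  rw [massMeasure_apply measurableSet_Ioo, re_preimage_inter_kochChain subset_rfl]
  have h : Measure.hausdorffMeasure (3 / 2 : ℝ)
      (kochBoundary ∩ Complex.re ⁻¹' Set.Ioo (-1 / 3) (4 / 3)) =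
        Measure.hausdorffMeasure (3 / 2 : ℝ) kochBoundary := by
    refine le_antisymm (measure_mono Set.inter_subset_left) ?_
    have hsub : kochBoundary ⊆ (kochBoundary ∩ Complex.re ⁻¹' Set.Ioo (-1 / 3) (4 / 3)) ∪
        (Complex.re ⁻¹' {-1 / 3} ∪ Complex.re ⁻¹' {4 / 3}) := by
      intro z hz
      obtain ⟨⟨h1, h2⟩, -⟩ := kochBoundary_subset_square hz
      rcases h1.eq_or_lt with h1 | h1
      · exact Or.inr (Or.inl h1.symm)
      rcases h2.eq_or_lt with h2 | h2
      · exact Or.inr (Or.inr h2)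
      · exact Or.inl ⟨hz, h1, h2⟩
    refine (measure_mono hsub).trans ((measure_union_le _ _).trans ?_)
    rw [measure_union_null (hausdorffMeasure_vertical_line _) (hausdorffMeasure_vertical_line _),
      add_zero]
  rw [h, ENNReal.inv_mul_cancel hausdorffMeasure_kochBoundary_pos.ne'
    hausdorffMeasure_kochBoundary_lt_top.ne]

theorem massMeasure_preimage_translate (k : ℤ) {B : Set ℝ} (hB : MeasurableSet B) :
    massMeasure ((fun x : ℝ => x + k * (5 / 3)) ⁻¹' B) = massMeasure B := by
  rw [massMeasure_apply hB, massMeasure_apply (hB.preimage (by fun_prop))]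
  congr 1
  set τ : ℂ → ℂ := fun z => z + (((k : ℝ) * (5 / 3) : ℝ) : ℂ) with hτ
  have hi : Isometry τ := Isometry.of_dist_eq fun z w => by simp [hτ]
  have hs : Function.Surjective τ := fun z =>
    ⟨z - (((k : ℝ) * (5 / 3) : ℝ) : ℂ), sub_add_cancel z _⟩
  have h : Complex.re ⁻¹' ((fun x : ℝ => x + k * (5 / 3)) ⁻¹' B) ∩ kochChain =
      τ ⁻¹' (Complex.re ⁻¹' B ∩ kochChain) := by
    rw [Set.preimage_inter]
    have hre : ∀ z, (τ z).re = z.re + k * (5 / 3) := fun z => by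
      simp only [hτ, Complex.add_re, Complex.ofReal_re]
    have hB : τ ⁻¹' (Complex.re ⁻¹' B) = Complex.re ⁻¹' ((fun x : ℝ => x + k * (5 / 3)) ⁻¹' B) := by
      ext z; simp only [Set.mem_preimage, hre]
    rw [hB]
    congr 1
    · ext z
      simp only [kochChain, Set.mem_iUnion, Set.mem_preimage]
      constructor
      · rintro ⟨l, y, hy, rfl⟩
        exact ⟨l + k, y, hy, by simp only [hτ]; push_cast; ring⟩
      · rintro ⟨l, y, hy, h⟩
        refine ⟨l - k, y, hy, ?_⟩
        apply hi.injective
        rw [← h]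
        simp only [hτ]; push_cast; ring
  rw [h, ← hi.hausdorffMeasure_image (Or.inl (by norm_num)), Set.image_preimage_eq _ hs]

theorem massMeasure_Icc_period (k : ℤ) :
    massMeasure (Set.Icc (-1 / 3 + k * (5 / 3)) (4 / 3 + k * (5 / 3))) = 1 := by
  rw [← massMeasure_preimage_translate k measurableSet_Icc, Set.preimage_add_const_Icc,
    add_sub_cancel_right, add_sub_cancel_right, ← massMeasure_Ioo_period]
  exact (measure_congr Ioo_ae_eq_Icc).symm

theorem exists_int_translate_mem (x : ℝ) :
    ∃ k : ℤ, -1 / 3 + k * (5 / 3) ≤ x ∧ x < 4 / 3 + k * (5 / 3) := by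
  refine ⟨⌊(x + 1 / 3) / (5 / 3)⌋, ?_, ?_⟩
  · have := Int.floor_le ((x + 1 / 3) / (5 / 3))
    rw [le_div_iff₀ (by norm_num)] at this
    linarith
  · have := Int.lt_floor_add_one ((x + 1 / 3) / (5 / 3))
    rw [div_lt_iff₀ (by norm_num)] at this
    linarith

instance : IsLocallyFiniteMeasure massMeasure := ⟨fun x => by
  obtain ⟨k, h1, h2⟩ := exists_int_translate_mem x
  refine ⟨Set.Icc (-1 / 3 + ((k - 1 : ℤ) : ℝ) * (5 / 3)) (4 / 3 + ((k - 1 : ℤ) : ℝ) * (5 / 3)) ∪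
    Set.Icc (-1 / 3 + k * (5 / 3)) (4 / 3 + k * (5 / 3)), ?_, measure_union_lt_top ?_ ?_⟩
  · refine mem_of_superset (Ioo_mem_nhds (a := x - 1) (b := 4 / 3 + k * (5 / 3)) (by linarith) h2)
      ?_
    rintro y ⟨hy1, hy2⟩
    rcases le_total (-1 / 3 + (k : ℝ) * (5 / 3)) y with h | h
    · exact Or.inr ⟨h, hy2.le⟩
    · refine Or.inl ⟨?_, ?_⟩ <;> push_cast <;> linarith
  · rw [massMeasure_Icc_period]; exact ENNReal.one_lt_top
  · rw [massMeasure_Icc_period]; exact ENNReal.one_lt_top⟩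

theorem massMeasure_Ioo_pos {a b : ℝ} (hab : a < b) : 0 < massMeasure (Set.Ioo a b) := by
  obtain ⟨k, h1, h2⟩ := exists_int_translate_mem a
  rw [← massMeasure_preimage_translate k measurableSet_Ioo, Set.preimage_add_const_Ioo]
  set b' := min (b - k * (5 / 3)) (4 / 3)
  have hb' : a - k * (5 / 3) < b' := lt_min (by linarith) (by linarith)
  have hsub : Set.Ioo (a - k * (5 / 3)) b' ⊆ Set.Ioo (-1 / 3) (4 / 3) :=
    Set.Ioo_subset_Ioo (by linarith) (min_le_right _ _)
  refine lt_of_lt_of_le ?_ (measure_mono (Set.Ioo_subset_Ioo_right (min_le_left _ (4 / 3))))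
  rw [massMeasure_apply measurableSet_Ioo, re_preimage_inter_kochChain hsub]
  refine ENNReal.mul_pos (ENNReal.inv_ne_zero.2 hausdorffMeasure_kochBoundary_lt_top.ne)
    (hausdorffMeasure_kochBoundary_inter_pos (isOpen_Ioo.preimage Complex.continuous_re) ?_).ne'
  obtain ⟨z, hz, hzB⟩ := exists_kochBoundary_re_mem (a := a - k * (5 / 3)) (b := b')
    (by linarith) hb' (min_le_right _ _)
  exact ⟨z, hz, hzB⟩

/-- The staircase is the primitive of the constant `1` with respect to `dv`. -/
theorem staircase_eq_integral (p ξ : ℝ) : staircase p ξ = ∫ _ in p..ξ, (1 : ℝ) ∂massMeasure := by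
  rw [staircase]
  split_ifs with h
  · rw [intervalIntegral.integral_of_le h, integral_Ioc_eq_integral_Ioo]
    simp [Measure.real]
  · rw [intervalIntegral.integral_of_ge (not_le.1 h).le, integral_Ioc_eq_integral_Ioo]
    simp [Measure.real]

theorem intervalIntegrable_one_massMeasure (a b : ℝ) :
    IntervalIntegrable (fun _ => (1 : ℝ)) massMeasure a b := intervalIntegrable_const

theorem staircase_sub_staircase (p a b : ℝ) : staircase p b - staircase p a = staircase a b := by
  simp only [staircase_eq_integral]
  exact intervalIntegral.integral_interval_sub_left (intervalIntegrable_one_massMeasure _ _)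
    (intervalIntegrable_one_massMeasure _ _)

theorem continuous_staircase (p : ℝ) : Continuous (staircase p) := by
  rw [funext (staircase_eq_integral p)]
  exact intervalIntegral.continuous_primitive intervalIntegrable_one_massMeasure p

theorem staircase_self (p : ℝ) : staircase p p = 0 := by simp [staircase]

theorem staircase_of_le {a b : ℝ} (h : a ≤ b) :
    staircase a b = (massMeasure (Set.Ioo a b)).toReal := if_pos h

theorem strictMono_staircase (p : ℝ) : StrictMono (staircase p) := fun a b hab => by
  rw [← sub_pos, staircase_sub_staircase, staircase_of_le hab.le]
  exact ENNReal.toReal_pos (massMeasure_Ioo_pos hab).ne' measure_Ioo_lt_top.ne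

theorem staircase_translate (k : ℤ) (a b : ℝ) :
    staircase (a + k * (5 / 3)) (b + k * (5 / 3)) = staircase a b := by
  have h : ∀ a b : ℝ, massMeasure (Set.Ioo (a + k * (5 / 3)) (b + k * (5 / 3))) =
      massMeasure (Set.Ioo a b) := fun a b => by
    rw [← massMeasure_preimage_translate k measurableSet_Ioo, Set.preimage_add_const_Ioo,
      add_sub_cancel_right, add_sub_cancel_right]
  simp only [staircase, h, add_le_add_iff_right]

theorem staircase_edge : staircase (-1 / 3) (4 / 3) = 1 := by
  rw [staircase_of_le (by norm_num), massMeasure_Ioo_period, ENNReal.toReal_one]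

theorem staircase_add_period (p ξ : ℝ) : staircase p (ξ + 5 / 3) = staircase p ξ + 1 := by
  -- the mass over a period does not depend on where the period starts
  have h1 := staircase_translate 1 (-1 / 3) ξ
  have h2 := staircase_sub_staircase (-1 / 3) (4 / 3) (ξ + 5 / 3)
  have h3 := staircase_sub_staircase p ξ (ξ + 5 / 3)
  have h4 := staircase_sub_staircase (-1 / 3) ξ (ξ + 5 / 3)
  rw [staircase_edge] at h2
  norm_num at h1 h2 h3 h4
  linarith

theorem staircase_add_int_mul (p ξ : ℝ) (k : ℤ) :
    staircase p (ξ + k * (5 / 3)) = staircase p ξ + k := by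
  induction k using Int.induction_on with
  | zero => simp
  | succ n ih =>
    have := staircase_add_period p (ξ + (n : ℤ) * (5 / 3))
    rw [ih] at this
    push_cast at this ⊢
    rw [show ξ + ((n : ℝ) + 1) * (5 / 3) = ξ + n * (5 / 3) + 5 / 3 by ring, this]; ring
  | pred n ih =>
    have := staircase_add_period p (ξ + (-(n : ℤ) - 1 : ℤ) * (5 / 3))
    rw [show ξ + ((-(n : ℤ) - 1 : ℤ) : ℝ) * (5 / 3) + 5 / 3 = ξ + ((-n : ℤ) : ℝ) * (5 / 3) by
      push_cast; ring, ih] at this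
    push_cast at this ⊢
    linarith

theorem surjective_staircase (p : ℝ) : Function.Surjective (staircase p) := by
  intro y
  have h1 := staircase_add_int_mul p p ⌊y⌋
  have h2 := staircase_add_int_mul p p (⌊y⌋ + 1)
  rw [staircase_self, zero_add] at h1 h2
  have hle : p + (⌊y⌋ : ℝ) * (5 / 3) ≤ p + ((⌊y⌋ + 1 : ℤ) : ℝ) * (5 / 3) := by
    push_cast; linarith
  obtain ⟨x, -, hx⟩ := intermediate_value_Icc hle (continuous_staircase p).continuousOn
    ⟨h1.trans_le (Int.floor_le y), by rw [h2]; push_cast; exact (Int.lt_floor_add_one y).le⟩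
  exact ⟨x, hx⟩

/-- The staircase with base point `p` as a homeomorphism of the line. -/
noncomputable def staircaseHomeo (p : ℝ) : ℝ ≃ₜ ℝ :=
  ((strictMono_staircase p).orderIsoOfSurjective _ (surjective_staircase p)).toHomeomorph

@[simp]
theorem coe_staircaseHomeo (p : ℝ) : ⇑(staircaseHomeo p) = staircase p := rfl

/-- The staircase maps `dv` to Lebesgue measure. -/
theorem measurePreserving_staircase (p : ℝ) :
    MeasurePreserving (staircase p) massMeasure volume := by
  refine ⟨(continuous_staircase p).measurable, ?_⟩
  have key : ∀ a b : ℝ, massMeasure.map (staircase p) (Set.Ioo a b) = volume (Set.Ioo a b) := by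
    intro a b
    obtain ⟨a', ha⟩ := surjective_staircase p a
    obtain ⟨b', hb⟩ := surjective_staircase p b
    rw [Measure.map_apply (continuous_staircase p).measurable measurableSet_Ioo, Real.volume_Ioo,
      ← ha, ← hb, staircase_sub_staircase]
    have hpre : staircase p ⁻¹' Set.Ioo (staircase p a') (staircase p b') = Set.Ioo a' b' := by
      ext x; simp [(strictMono_staircase p).lt_iff_lt]
    rw [hpre]
    rcases le_total a' b' with h | h
    · rw [staircase_of_le h, ENNReal.ofReal_toReal measure_Ioo_lt_top.ne]
    · rw [Set.Ioo_eq_empty (not_lt.2 h), measure_empty, ENNReal.ofReal_of_nonpos]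
      rw [← staircase_self a']
      exact (strictMono_staircase a').monotone h
  have : IsLocallyFiniteMeasure (massMeasure.map (staircase p)) := ⟨fun x =>
    ⟨_, Ioo_mem_nhds (sub_one_lt x) (lt_add_one x), by rw [key]; exact measure_Ioo_lt_top⟩⟩
  exact Real.measure_ext_Ioo_rat fun a b => key a b

/-! ### The domain bounded by the curve -/

theorem isOpen_compl_kochBoundary : IsOpen kochBoundaryᶜ :=
  isCompact_kochBoundary.isClosed.isOpen_compl

theorem isOpen_kochDomain : IsOpen kochDomain := by
  rw [isOpen_iff_mem_nhds]
  rintro z ⟨hz, hb⟩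
  refine mem_of_superset ((isOpen_compl_kochBoundary.connectedComponentIn).mem_nhds
    (mem_connectedComponentIn hz)) fun w hw => ⟨connectedComponentIn_subset _ _ hw, ?_⟩
  rwa [← connectedComponentIn_eq hw]

theorem closure_kochDomain_subset : closure kochDomain ⊆ kochDomain ∪ kochBoundary := by
  intro z hz
  by_contra h
  rw [Set.mem_union, not_or] at h
  obtain ⟨w, hw, hwD⟩ := mem_closure_iff.1 hz _ isOpen_compl_kochBoundary.connectedComponentIn
    (mem_connectedComponentIn (F := kochBoundaryᶜ) h.2)
  refine h.1 ⟨h.2, ?_⟩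
  rw [connectedComponentIn_eq hw]
  exact hwD.2

/-- A point from which a ray leads to infinity off the curve is not in the domain. -/
theorem not_mem_kochDomain_of_ray {z d : ℂ} (hd : ‖d‖ = 1)
    (h : ∀ t : ℝ, 0 ≤ t → z + t * d ∉ kochBoundary) : z ∉ kochDomain := by
  rintro ⟨-, hb⟩
  have hray : IsPreconnected ((fun t : ℝ => z + t * d) '' Set.Ici 0) :=
    isPreconnected_Ici.image _ (by fun_prop)
  have hsub := hray.subset_connectedComponentIn (x := z) (F := kochBoundaryᶜ)
    ⟨0, by simp, by simp⟩ (by rintro _ ⟨t, ht, rfl⟩; exact h t ht)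
  obtain ⟨R, hR⟩ := (hb.subset hsub).exists_norm_le
  have h1 := hR _ ⟨|R| + ‖z‖ + 1, by simp only [Set.mem_Ici]; positivity, rfl⟩
  have h2 := norm_sub_le (z + ((|R| + ‖z‖ + 1 : ℝ) : ℂ) * d) z
  rw [add_sub_cancel_left, norm_mul, hd, mul_one, Complex.norm_real, Real.norm_of_nonneg
    (by positivity)] at h2
  linarith [le_abs_self R]

theorem kochDomain_subset_closedSquare {z : ℂ} (hz : z ∈ kochDomain) :
    (-1 / 3 ≤ z.re ∧ z.re ≤ 4 / 3) ∧ (-1 / 3 ≤ z.im ∧ z.im ≤ 4 / 3) := by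
  refine ⟨⟨?_, ?_⟩, ⟨?_, ?_⟩⟩ <;> by_contra! hlt
  · refine not_mem_kochDomain_of_ray (d := -1) (by simp) (fun t ht hmem => ?_) hz
    have := (kochBoundary_subset_square hmem).1.1
    simp at this; linarith
  · refine not_mem_kochDomain_of_ray (d := 1) (by simp) (fun t ht hmem => ?_) hz
    have := (kochBoundary_subset_square hmem).1.2
    simp at this; linarith
  · refine not_mem_kochDomain_of_ray (d := -Complex.I) (by simp) (fun t ht hmem => ?_) hz
    have := (kochBoundary_subset_square hmem).2.1
    simp at this; linarith
  · refine not_mem_kochDomain_of_ray (d := Complex.I) (by simp) (fun t ht hmem => ?_) hz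
    have := (kochBoundary_subset_square hmem).2.2
    simp at this; linarith

theorem isOpen_waveCylinder : IsOpen waveCylinder := by
  have h : Continuous fun p : Fin 3 → ℝ => (⟨p 1, p 2⟩ : ℂ) := by
    have : (fun p : Fin 3 → ℝ => (⟨p 1, p 2⟩ : ℂ)) =
        fun p => (p 1 : ℂ) + (p 2 : ℂ) * Complex.I := by
      ext p; exact Complex.mk_eq_add_mul_I _ _
    rw [this]; fun_prop
  exact (isOpen_lt continuous_const (continuous_apply 0)).inter (isOpen_kochDomain.preimage h)

/-! ### Fractal derivatives as ordinary derivatives in the scaling variable -/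

/-- In the variable `v`, the fractal derivative is the ordinary one. -/
theorem hasFractalDerivAt_iff (e : ℝ ≃ₜ ℝ) (f : ℝ → ℝ) (d a : ℝ) :
    HasFractalDerivAt e f d a ↔ HasDerivAt (f ∘ e.symm) d (e a) := by
  rw [hasDerivAt_iff_tendsto_slope, HasFractalDerivAt, fractalNhds]
  have h : (fun s => (f s - f a) / (e s - e a)) = slope (f ∘ e.symm) (e a) ∘ e := by
    ext s
    simp [slope_def_field]
  rw [h, ← Filter.tendsto_map'_iff, Filter.map_comap_of_surjective e.surjective]

theorem HasFractalDerivAt.fractalDeriv_eq {e : ℝ ≃ₜ ℝ} {f : ℝ → ℝ} {d a : ℝ}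
    (h : HasFractalDerivAt e f d a) : fractalDeriv e f a = d := by
  have : (fractalNhds e a).NeBot := NeBot.comap_of_surj inferInstance e.surjective
  exact Tendsto.limUnder_eq h

/-- The scaling variables as homeomorphisms of the line. -/
noncomputable def scalingHomeo (i : Fin 3) : ℝ ≃ₜ ℝ :=
  staircaseHomeo ((![0, -1 / 3, -1 / 3] : Fin 3 → ℝ) i)

theorem scalingVar_eq (i : Fin 3) : scalingVar i = scalingHomeo i := by
  fin_cases i <;> rfl

/-- The change of variables `(T, x, y) ↦ (v(T), v(x), v(y))`. -/
noncomputable def scaling : (Fin 3 → ℝ) ≃ₜ (Fin 3 → ℝ) :=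
  Homeomorph.piCongrRight scalingHomeo

theorem scaling_apply (p : Fin 3 → ℝ) (i : Fin 3) : scaling p i = scalingVar i (p i) := by
  rw [scalingVar_eq]; rfl

/-- The ordinary partial derivative of `u` in the coordinate `i` exists at `q` and is `d`. -/
def HasPartialAt (i : Fin 3) (u : (Fin 3 → ℝ) → ℝ) (d : ℝ) (q : Fin 3 → ℝ) : Prop :=
  HasDerivAt (fun s => u (Function.update q i s)) d (q i)

/-- All ordinary partial derivatives of order up to `n`, mixed ones included, exist and are
continuous on `S`: the counterpart of `FractalContDiffOn` in the scaling variables. -/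
def PartialContDiffOn : ℕ → ((Fin 3 → ℝ) → ℝ) → Set (Fin 3 → ℝ) → Prop
  | 0, u, S => ContinuousOn u S
  | n + 1, u, S => ContinuousOn u S ∧ ∀ i : Fin 3, ∃ u' : (Fin 3 → ℝ) → ℝ,
      (∀ q ∈ S, HasPartialAt i u (u' q) q) ∧ PartialContDiffOn n u' S

theorem hasFractalPartialAt_comp_scaling (i : Fin 3) (u : (Fin 3 → ℝ) → ℝ) (d : ℝ)
    (p : Fin 3 → ℝ) :
    HasFractalPartialAt i (fun p => u (scaling p)) d p ↔ HasPartialAt i u d (scaling p) := by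
  rw [HasFractalPartialAt, HasPartialAt, scaling_apply, scalingVar_eq, hasFractalDerivAt_iff]
  have : (fun s => u (scaling (Function.update p i s))) ∘ (scalingHomeo i).symm =
      fun s => u (Function.update (scaling p) i s) := by
    ext s
    simp only [Function.comp]
    congr 1
    ext j
    rw [scaling_apply, scalingVar_eq]
    by_cases h : j = i
    · subst h; simp
    · simp [h, scaling_apply, scalingVar_eq]
  rw [this]

theorem fractalContDiffOn_comp_scaling (n : ℕ) (u : (Fin 3 → ℝ) → ℝ) (S : Set (Fin 3 → ℝ)) :
    FractalContDiffOn n (fun p => u (scaling p)) (scaling ⁻¹' S) ↔ PartialContDiffOn n u S := by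
  have hcont : ∀ u : (Fin 3 → ℝ) → ℝ, ContinuousOn (fun p => u (scaling p)) (scaling ⁻¹' S) ↔
      ContinuousOn u S := fun u => by
    constructor
    · intro h
      have := h.comp (scaling.symm.continuous.continuousOn (s := S)) fun q hq => by simpa using hq
      exact this.congr fun q _ => by simp
    · exact fun h => h.comp scaling.continuous.continuousOn fun p hp => hp
  induction n generalizing u with
  | zero => exact hcont u
  | succ n ih =>
    rw [FractalContDiffOn, PartialContDiffOn, hcont]
    refine and_congr_right fun _ => forall_congr' fun i => ?_
    constructor
    · rintro ⟨U', h1, h2⟩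
      refine ⟨fun q => U' (scaling.symm q), fun q hq => ?_, (ih _).1 (by simpa using h2)⟩
      have := (hasFractalPartialAt_comp_scaling i u _ _).1 (h1 (scaling.symm q) (by simpa using hq))
      simpa using this
    · rintro ⟨u', h1, h2⟩
      exact ⟨fun p => u' (scaling p),
        fun p hp => (hasFractalPartialAt_comp_scaling i u _ p).2 (h1 _ hp), (ih u').2 h2⟩

theorem HasPartialAt.classicalPartial_eq {i : Fin 3} {u : (Fin 3 → ℝ) → ℝ} {d : ℝ}
    {q : Fin 3 → ℝ} (h : HasPartialAt i u d q) : classicalPartial i u q = d := h.deriv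

theorem HasFractalPartialAt.fractalPartial_eq {i : Fin 3} {U : (Fin 3 → ℝ) → ℝ} {d : ℝ}
    {p : Fin 3 → ℝ} (h : HasFractalPartialAt i U d p) : fractalPartial i U p = d := by
  rw [HasFractalPartialAt, scalingVar_eq] at h
  rw [fractalPartial, scalingVar_eq]
  exact h.fractalDeriv_eq

theorem HasPartialAt.congr_of_eqOn {i : Fin 3} {u u' : (Fin 3 → ℝ) → ℝ} {d : ℝ}
    {W : Set (Fin 3 → ℝ)} {q : Fin 3 → ℝ} (h : HasPartialAt i u d q) (hW : IsOpen W) (hq : q ∈ W)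
    (he : Set.EqOn u' u W) : HasPartialAt i u' d q := by
  refine HasDerivAt.congr_of_eventuallyEq h ?_
  have hc : ContinuousAt (fun s => Function.update q i s) (q i) := by fun_prop
  have := hc.eventually_mem (s := W) (hW.mem_nhds (by simpa using hq))
  filter_upwards [this] with s hs using he hs

/-- The value of a second partial derivative from its existence. The first derivative is known only
on `W`, and `W` being open makes this enough. -/
theorem classicalPartial_classicalPartial_eq {i : Fin 3} {u u₁ : (Fin 3 → ℝ) → ℝ} {d : ℝ}
    {W : Set (Fin 3 → ℝ)} (hW : IsOpen W) (h1 : ∀ q ∈ W, HasPartialAt i u (u₁ q) q)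
    {q : Fin 3 → ℝ} (hq : q ∈ W) (h2 : HasPartialAt i u₁ d q) :
    classicalPartial i (classicalPartial i u) q = d :=
  (h2.congr_of_eqOn hW hq fun q hq => (h1 q hq).classicalPartial_eq).classicalPartial_eq

theorem fractalPartial_fractalPartial_eq {i : Fin 3} {u u₁ : (Fin 3 → ℝ) → ℝ} {d : ℝ}
    {W : Set (Fin 3 → ℝ)} (hW : IsOpen W) (h1 : ∀ q ∈ W, HasPartialAt i u (u₁ q) q)
    {p : Fin 3 → ℝ} (hp : scaling p ∈ W) (h2 : HasPartialAt i u₁ d (scaling p)) :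
    fractalPartial i (fractalPartial i fun p => u (scaling p)) p = d := by
  refine HasFractalPartialAt.fractalPartial_eq ?_
  obtain ⟨w, hw⟩ : ∃ w : (Fin 3 → ℝ) → ℝ,
      fractalPartial i (fun p => u (scaling p)) = fun p => w (scaling p) :=
    ⟨fun q => fractalPartial i (fun p => u (scaling p)) (scaling.symm q), by simp⟩
  rw [hw, hasFractalPartialAt_comp_scaling]
  refine h2.congr_of_eqOn hW hp fun q hq => ?_
  have h := congrFun hw (scaling.symm q)
  rw [scaling.apply_symm_apply] at h
  rw [← h]
  refine HasFractalPartialAt.fractalPartial_eq ?_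
  rw [hasFractalPartialAt_comp_scaling, scaling.apply_symm_apply]
  exact h1 q hq

/-! ### Renormalization -/

theorem ContDiffOn.hasPartialAt {n : WithTop ℕ∞} (hn : n ≠ 0) {u : (Fin 3 → ℝ) → ℝ}
    {W : Set (Fin 3 → ℝ)} (hW : IsOpen W) (hu : ContDiffOn ℝ n u W) (i : Fin 3)
    {q : Fin 3 → ℝ} (hq : q ∈ W) : HasPartialAt i u (fderiv ℝ u q (Pi.single i 1)) q := by
  have h1 : HasFDerivAt u (fderiv ℝ u q) (Function.update q i (q i)) := by
    rw [Function.update_eq_self]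
    exact ((hu.contDiffAt (hW.mem_nhds hq)).differentiableAt hn).hasFDerivAt
  exact h1.comp_hasDerivAt (q i) (hasDerivAt_update q i (q i))

theorem ContDiffOn.fderiv_single {n : ℕ} {u : (Fin 3 → ℝ) → ℝ}
    {W : Set (Fin 3 → ℝ)} (hW : IsOpen W) (hu : ContDiffOn ℝ (n + 1 : ℕ) u W) (i : Fin 3) :
    ContDiffOn ℝ n (fun q => fderiv ℝ u q (Pi.single i 1)) W :=
  (hu.fderiv_of_isOpen (m := n) hW (by norm_cast)).clm_apply contDiffOn_const

theorem ContDiffOn.partialContDiffOn (n : ℕ) {u : (Fin 3 → ℝ) → ℝ}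
    {W : Set (Fin 3 → ℝ)} (hW : IsOpen W) (hu : ContDiffOn ℝ n u W) : PartialContDiffOn n u W := by
  induction n generalizing u with
  | zero => exact hu.continuousOn
  | succ n ih =>
    refine ⟨hu.continuousOn, fun i => ⟨_, fun q hq => ?_, ih (ContDiffOn.fderiv_single hW hu i)⟩⟩
    exact ContDiffOn.hasPartialAt (by simp) hW hu i hq

/-- A partial derivative after a linear change of scale `q ↦ (j ↦ l j * q j)`. -/
theorem HasPartialAt.comp_mul {i : Fin 3} {u : (Fin 3 → ℝ) → ℝ} {d : ℝ} (l q : Fin 3 → ℝ)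
    (h : HasPartialAt i u d fun j => l j * q j) :
    HasPartialAt i (fun q => u fun j => l j * q j) (l i * d) q := by
  have h2 := HasDerivAt.comp (q i) (h₂ := fun s => u (Function.update (fun j => l j * q j) i s)) h
    ((hasDerivAt_id (q i)).const_mul (l i))
  rw [mul_one, mul_comm] at h2
  refine HasDerivAt.congr_of_eventuallyEq h2 (Eventually.of_forall fun s => ?_)
  simp only [Function.comp]
  congr 1
  ext j
  by_cases hj : j = i
  · subst hj; simp
  · simp [hj]

theorem renormalize_eq (c κ : ℝ) (p : Fin 3 → ℝ) :
    renormalize c κ p = fun j => (![κ / c, 1, 1] : Fin 3 → ℝ) j * scaling p j := by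
  ext j
  fin_cases j <;> simp [renormalize, scaling_apply]

theorem renormalization {c κ : ℝ} (hc : 0 < c) (hκ : 0 < κ) {S : Set (Fin 3 → ℝ)} (hS : IsOpen S)
    (u : (Fin 3 → ℝ) → ℝ) (hu : ContDiffOn ℝ 2 u (renormalize c κ '' S)) :
    FractalContDiffOn 2 (fun p => u (renormalize c κ p)) S ∧
      ∀ p ∈ S, (FractalWaveAt κ (fun p => u (renormalize c κ p)) p ↔
        ClassicalWaveAt c u (renormalize c κ p)) := by
  set l : Fin 3 → ℝ := ![κ / c, 1, 1] with hl
  have hl0 : ∀ j, l j ≠ 0 := fun j => by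
    fin_cases j <;> simp [hl, hc.ne', hκ.ne']
  let e : (Fin 3 → ℝ) ≃ₜ (Fin 3 → ℝ) := Homeomorph.piCongrRight fun j =>
    Homeomorph.mulLeft₀ (l j) (hl0 j)
  have he : ∀ p, renormalize c κ p = e (scaling p) := renormalize_eq c κ
  have hW : IsOpen (renormalize c κ '' S) := by
    rw [funext he]
    exact (scaling.trans e).isOpenMap S hS
  have hW' : IsOpen (scaling '' S) := scaling.isOpenMap S hS
  set W := renormalize c κ '' S
  have hmaps : ∀ q ∈ scaling '' S, (fun j => l j * q j) ∈ W := by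
    rintro _ ⟨p, hp, rfl⟩
    exact ⟨p, hp, he p⟩
  have hg : ContDiffOn ℝ 2 (fun q : Fin 3 → ℝ => u fun j => l j * q j) (scaling '' S) := by
    refine hu.comp (ContDiff.contDiffOn ?_) hmaps
    fun_prop
  have hU : (fun p => u (renormalize c κ p)) =
      fun p => (fun q : Fin 3 → ℝ => u fun j => l j * q j) (scaling p) :=
    funext fun p => by rw [he]; rfl
  have hSpre : S = scaling ⁻¹' (scaling '' S) := (Set.preimage_image_eq _ scaling.injective).symm
  rw [hU]
  refine ⟨?_, fun p hp => ?_⟩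
  · rw [hSpre]
    refine (fractalContDiffOn_comp_scaling 2 (fun q : Fin 3 → ℝ => u fun j => l j * q j) _).2 ?_
    exact ContDiffOn.partialContDiffOn 2 hW' hg
  · have hu' : ContDiffOn ℝ ((1 + 1 : ℕ) : WithTop ℕ∞) u W := by exact_mod_cast hu
    have h1 : ∀ i, ∀ q ∈ W, HasPartialAt i u (fderiv ℝ u q (Pi.single i 1)) q := fun i q hq =>
      ContDiffOn.hasPartialAt (by simp) hW hu i hq
    have h2 : ∀ i, ∃ d, HasPartialAt i (fun q => fderiv ℝ u q (Pi.single i 1)) d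
        (renormalize c κ p) := fun i =>
      ⟨_, ContDiffOn.hasPartialAt (n := (1 : ℕ)) (by simp) hW (ContDiffOn.fderiv_single hW hu' i) i
        ⟨p, hp, rfl⟩⟩
    choose d hd using h2
    have hclass : ∀ i, classicalPartial i (classicalPartial i u) (renormalize c κ p) = d i :=
      fun i => classicalPartial_classicalPartial_eq hW (h1 i) ⟨p, hp, rfl⟩ (hd i)
    have hfract : ∀ i, fractalPartial i (fractalPartial i fun p =>
        (fun q : Fin 3 → ℝ => u fun j => l j * q j) (scaling p)) p = l i * (l i * d i) := by
      intro i
      refine fractalPartial_fractalPartial_eq hW' (u₁ := fun q => l i *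
        (fun q => fderiv ℝ u q (Pi.single i 1)) fun j => l j * q j)
        (fun q hq => (h1 i _ (hmaps q hq)).comp_mul l q) ⟨p, hp, rfl⟩ ?_
      have := (hd i)
      rw [renormalize_eq] at this
      exact HasDerivAt.const_mul (l i) (this.comp_mul l (scaling p))
    rw [FractalWaveAt, ClassicalWaveAt]
    simp only [hclass, hfract]
    have e0 : l 0 = κ / c := rfl
    have e1 : l 1 = 1 := rfl
    have e2 : l 2 = 1 := rfl
    rw [e0, e1, e2]
    have hk2 : κ ^ 2 ≠ 0 := by positivity
    have hc2 : c ^ 2 ≠ 0 := by positivity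
    rw [show κ / c * (κ / c * d 0) = κ ^ 2 * (d 0 / c ^ 2) by field_simp, mul_right_inj' hk2,
      div_eq_iff hc2]
    simp only [one_mul, mul_comm]

/-! ### Trigonometric series -/

/-- The series `∑ B_k ∏ᵢ sin(λ_{k,i} qᵢ + φᵢ)`. The phases `φ` make the class of these series
closed under partial differentiation, which adds `π / 2` to one of them. -/
noncomputable def trigSeries {K : Type*} (lam : K → Fin 3 → ℝ) (B : K → ℝ) (φ q : Fin 3 → ℝ) : ℝ :=
  ∑' k, B k * ∏ i, Real.sin (lam k i * q i + φ i)

variable {K : Type*} {lam : K → Fin 3 → ℝ} {B : K → ℝ}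

theorem norm_trigTerm_le (B : ℝ) (φ q l : Fin 3 → ℝ) :
    ‖B * ∏ i, Real.sin (l i * q i + φ i)‖ ≤ |B| := by
  rw [norm_mul, Real.norm_eq_abs, norm_prod]
  exact mul_le_of_le_one_right (abs_nonneg _)
    (Finset.prod_le_one (fun _ _ => norm_nonneg _) fun _ _ => Real.abs_sin_le_one _)

theorem summable_trigTerm (hB : Summable fun k => |B k|) (φ q : Fin 3 → ℝ) :
    Summable fun k => B k * ∏ i, Real.sin (lam k i * q i + φ i) :=
  Summable.of_norm_bounded hB fun k => norm_trigTerm_le (B k) φ q (lam k)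

theorem continuous_trigSeries (hB : Summable fun k => |B k|) (φ : Fin 3 → ℝ) :
    Continuous (trigSeries lam B φ) :=
  continuous_tsum (fun k => by fun_prop) hB fun k q => norm_trigTerm_le (B k) φ q (lam k)

theorem hasPartialAt_trigSeries (hB : Summable fun k => |B k|) (i : Fin 3)
    (hBi : Summable fun k => |B k * lam k i|) (φ q : Fin 3 → ℝ) :
    HasPartialAt i (trigSeries lam B φ)
      (trigSeries lam (fun k => B k * lam k i) (Function.update φ i (φ i + Real.pi / 2)) q) q := by
  have hterm : ∀ (k : K) (s : ℝ), HasDerivAt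
      (fun s => B k * ∏ j, Real.sin (lam k j * Function.update q i s j + φ j))
      (B k * lam k i * ∏ j, Real.sin (lam k j * Function.update q i s j +
        Function.update φ i (φ i + Real.pi / 2) j)) s := by
    intro k s
    have hs : ∀ s, ∏ j, Real.sin (lam k j * Function.update q i s j + φ j) =
        Real.sin (lam k i * s + φ i) *
          ∏ j ∈ Finset.univ.erase i, Real.sin (lam k j * q j + φ j) := by
      intro s
      rw [← Finset.mul_prod_erase _ _ (Finset.mem_univ i), Function.update_self]
      congr 1
      refine Finset.prod_congr rfl fun j hj => ?_
      rw [Function.update_of_ne (Finset.ne_of_mem_erase hj)]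
    have hs' : ∏ j, Real.sin (lam k j * Function.update q i s j +
        Function.update φ i (φ i + Real.pi / 2) j) =
        Real.cos (lam k i * s + φ i) *
          ∏ j ∈ Finset.univ.erase i, Real.sin (lam k j * q j + φ j) := by
      rw [← Finset.mul_prod_erase _ _ (Finset.mem_univ i), Function.update_self,
        Function.update_self, ← add_assoc, Real.sin_add_pi_div_two]
      congr 1
      refine Finset.prod_congr rfl fun j hj => ?_
      rw [Function.update_of_ne (Finset.ne_of_mem_erase hj),
        Function.update_of_ne (Finset.ne_of_mem_erase hj)]
    simp only [hs, hs']
    have h1 : HasDerivAt (fun s => Real.sin (lam k i * s + φ i))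
        (Real.cos (lam k i * s + φ i) * lam k i) s := by
      have := (((hasDerivAt_id s).const_mul (lam k i)).add_const (φ i)).sin
      simpa using this
    exact ((h1.mul_const _).const_mul (B k)).congr_deriv (by ring)
  have h := hasDerivAt_tsum hBi hterm (fun k s => norm_trigTerm_le _ _ _ (lam k))
    (y₀ := q i) (summable_trigTerm hB φ _) (q i)
  rw [HasPartialAt]
  rw [Function.update_eq_self] at h
  exact h

theorem partialContDiffOn_trigSeries (hB : Summable fun k => |B k|)
    (hB1 : ∀ i, Summable fun k => |B k * lam k i|)
    (hB2 : ∀ i j, Summable fun k => |B k * lam k i * lam k j|) (φ : Fin 3 → ℝ) :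
    PartialContDiffOn 2 (trigSeries lam B φ) Set.univ :=
  ⟨(continuous_trigSeries hB φ).continuousOn, fun i =>
    ⟨_, fun q _ => hasPartialAt_trigSeries hB i (hB1 i) φ q,
      (continuous_trigSeries (hB1 i) _).continuousOn, fun j =>
        ⟨_, fun q _ => hasPartialAt_trigSeries (hB1 i) j (hB2 i j) _ q,
          (continuous_trigSeries (hB2 i j) _).continuousOn⟩⟩⟩

/-- Two derivatives in the same variable turn the phase by `π`. -/
theorem trigSeries_half_turn (i : Fin 3) (φ q : Fin 3 → ℝ) :
    trigSeries lam B (Function.update (Function.update φ i (φ i + Real.pi / 2)) i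
      (Function.update φ i (φ i + Real.pi / 2) i + Real.pi / 2)) q = -trigSeries lam B φ q := by
  rw [trigSeries, trigSeries, ← tsum_neg]
  refine tsum_congr fun k => ?_
  rw [Function.update_idem, Function.update_self, ← mul_neg,
    ← Finset.mul_prod_erase _ _ (Finset.mem_univ i),
    ← Finset.mul_prod_erase _ _ (Finset.mem_univ i),
    Function.update_self, show lam k i * q i + (φ i + Real.pi / 2 + Real.pi / 2) =
      lam k i * q i + φ i + Real.pi by ring, Real.sin_add_pi, neg_mul]
  congr 3
  refine Finset.prod_congr rfl fun j hj => ?_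
  rw [Function.update_of_ne (Finset.ne_of_mem_erase hj)]

/-! ### The series solution -/

/-- The frequencies of the `(m, n)`-th separated-variable term. -/
noncomputable def waveFrequency (κ : ℝ) (k : ℕ+ × ℕ+) : Fin 3 → ℝ :=
  ![Real.pi * κ * √((k.1 : ℝ) ^ 2 + (k.2 : ℝ) ^ 2), Real.pi * (k.1 : ℝ), Real.pi * (k.2 : ℝ)]

/-- The phases of the solution: a cosine in time, sines in space. -/
noncomputable def wavePhase : Fin 3 → ℝ := ![Real.pi / 2, 0, 0]

theorem seriesTerm_eq (κ : ℝ) (A : ℕ+ → ℕ+ → ℝ) (p : Fin 3 → ℝ) (k : ℕ+ × ℕ+) :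
    seriesTerm κ A p k = A k.1 k.2 *
      ∏ i, Real.sin (waveFrequency κ k i * scaling p i + wavePhase i) := by
  simp only [Fin.prod_univ_three, waveFrequency, wavePhase, scaling_apply, seriesTerm]
  simp [Real.sin_add_pi_div_two]
  ring

theorem seriesSolution_eq (κ : ℝ) (A : ℕ+ → ℕ+ → ℝ) :
    seriesSolution κ A =
      fun p => trigSeries (waveFrequency κ) (fun k => A k.1 k.2) wavePhase (scaling p) := by
  ext p
  exact tsum_congr fun k => seriesTerm_eq κ A p k

theorem one_le_sq_add_sq (k : ℕ+ × ℕ+) : (1 : ℝ) ≤ (k.1 : ℝ) ^ 2 + (k.2 : ℝ) ^ 2 := by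
  have : (1 : ℝ) ≤ k.1 := by exact_mod_cast one_le
  nlinarith [sq_nonneg (k.2 : ℝ)]

theorem summable_coefficient {A : ℕ+ → ℕ+ → ℝ}
    (hA : Summable fun k : ℕ+ × ℕ+ => ((k.1 : ℝ) ^ 2 + (k.2 : ℝ) ^ 2) * |A k.1 k.2|) :
    Summable fun k : ℕ+ × ℕ+ => |A k.1 k.2| :=
  Summable.of_nonneg_of_le (fun _ => abs_nonneg _)
    (fun k => le_mul_of_one_le_left (abs_nonneg _) (one_le_sq_add_sq k)) hA

theorem abs_waveFrequency_le {κ : ℝ} (hκ : 0 < κ) (k : ℕ+ × ℕ+) (i : Fin 3) :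
    |waveFrequency κ k i| ≤ Real.pi * (κ + 1) * √((k.1 : ℝ) ^ 2 + (k.2 : ℝ) ^ 2) := by
  have hπ := Real.pi_pos
  have h1 : (k.1 : ℝ) ≤ √((k.1 : ℝ) ^ 2 + (k.2 : ℝ) ^ 2) := Real.le_sqrt_of_sq_le (by
    nlinarith [sq_nonneg (k.2 : ℝ)])
  have h2 : (k.2 : ℝ) ≤ √((k.1 : ℝ) ^ 2 + (k.2 : ℝ) ^ 2) := Real.le_sqrt_of_sq_le (by
    nlinarith [sq_nonneg (k.1 : ℝ)])
  have h0 := Real.sqrt_nonneg ((k.1 : ℝ) ^ 2 + (k.2 : ℝ) ^ 2)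
  have hκ1 : Real.pi ≤ Real.pi * (κ + 1) := by nlinarith
  rw [abs_of_nonneg (by fin_cases i <;> simp [waveFrequency] <;> positivity)]
  fin_cases i
  · simp only [waveFrequency]
    show Real.pi * κ * _ ≤ _
    gcongr; linarith
  · show Real.pi * (k.1 : ℝ) ≤ _
    gcongr
  · show Real.pi * (k.2 : ℝ) ≤ _
    gcongr

theorem summable_coefficient_mul {κ : ℝ} (hκ : 0 < κ) {A : ℕ+ → ℕ+ → ℝ}
    (hA : Summable fun k : ℕ+ × ℕ+ => ((k.1 : ℝ) ^ 2 + (k.2 : ℝ) ^ 2) * |A k.1 k.2|) (i : Fin 3) :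
    Summable fun k : ℕ+ × ℕ+ => |A k.1 k.2 * waveFrequency κ k i| := by
  refine Summable.of_nonneg_of_le (fun _ => abs_nonneg _) (fun k => ?_)
    (hA.mul_left (Real.pi * (κ + 1)))
  rw [abs_mul, ← mul_assoc, mul_comm]
  gcongr
  refine (abs_waveFrequency_le hκ k i).trans ?_
  gcongr
  exact Real.sqrt_le_iff.2 ⟨by positivity, by nlinarith [one_le_sq_add_sq k]⟩

theorem summable_coefficient_mul_mul {κ : ℝ} (hκ : 0 < κ) {A : ℕ+ → ℕ+ → ℝ}
    (hA : Summable fun k : ℕ+ × ℕ+ => ((k.1 : ℝ) ^ 2 + (k.2 : ℝ) ^ 2) * |A k.1 k.2|)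
    (i j : Fin 3) :
    Summable fun k : ℕ+ × ℕ+ => |A k.1 k.2 * waveFrequency κ k i * waveFrequency κ k j| := by
  refine Summable.of_nonneg_of_le (fun _ => abs_nonneg _) (fun k => ?_)
    (hA.mul_left ((Real.pi * (κ + 1)) ^ 2))
  rw [mul_assoc, abs_mul, abs_mul, ← mul_assoc _ _ |A k.1 k.2|, mul_comm]
  refine mul_le_mul_of_nonneg_right ?_ (abs_nonneg _)
  have h := Real.mul_self_sqrt (zero_le_one.trans (one_le_sq_add_sq k))
  calc _ ≤ (Real.pi * (κ + 1) * √((k.1 : ℝ) ^ 2 + (k.2 : ℝ) ^ 2)) *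
        (Real.pi * (κ + 1) * √((k.1 : ℝ) ^ 2 + (k.2 : ℝ) ^ 2)) :=
        mul_le_mul (abs_waveFrequency_le hκ k i) (abs_waveFrequency_le hκ k j) (abs_nonneg _)
          ((abs_nonneg _).trans (abs_waveFrequency_le hκ k i))
    _ = _ := by rw [mul_mul_mul_comm, h]; ring

theorem continuous_seriesSolution (κ : ℝ) {A : ℕ+ → ℕ+ → ℝ}
    (hA : Summable fun k : ℕ+ × ℕ+ => ((k.1 : ℝ) ^ 2 + (k.2 : ℝ) ^ 2) * |A k.1 k.2|) :
    Continuous (seriesSolution κ A) := by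
  rw [seriesSolution_eq]
  exact (continuous_trigSeries (summable_coefficient hA) _).comp scaling.continuous

theorem fractalContDiffOn_seriesSolution {κ : ℝ} (hκ : 0 < κ) {A : ℕ+ → ℕ+ → ℝ}
    (hA : Summable fun k : ℕ+ × ℕ+ => ((k.1 : ℝ) ^ 2 + (k.2 : ℝ) ^ 2) * |A k.1 k.2|) :
    FractalContDiffOn 2 (seriesSolution κ A) Set.univ := by
  rw [seriesSolution_eq]
  exact (fractalContDiffOn_comp_scaling 2 _ Set.univ).2 (partialContDiffOn_trigSeries
    (summable_coefficient hA) (summable_coefficient_mul hκ hA)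
    (summable_coefficient_mul_mul hκ hA) _)

theorem fractalWaveAt_seriesSolution {κ : ℝ} (hκ : 0 < κ) {A : ℕ+ → ℕ+ → ℝ}
    (hA : Summable fun k : ℕ+ × ℕ+ => ((k.1 : ℝ) ^ 2 + (k.2 : ℝ) ^ 2) * |A k.1 k.2|)
    (p : Fin 3 → ℝ) :
    FractalWaveAt κ (seriesSolution κ A) p := by
  rw [seriesSolution_eq, FractalWaveAt]
  have h : ∀ i, fractalPartial i (fractalPartial i fun p =>
      trigSeries (waveFrequency κ) (fun k => A k.1 k.2) wavePhase (scaling p)) p =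
      -trigSeries (waveFrequency κ)
        (fun k => A k.1 k.2 * waveFrequency κ k i * waveFrequency κ k i) wavePhase (scaling p) := by
    intro i
    rw [← trigSeries_half_turn i]
    exact fractalPartial_fractalPartial_eq isOpen_univ
      (fun q _ => hasPartialAt_trigSeries (summable_coefficient hA) i
        (summable_coefficient_mul hκ hA i) _ q) (Set.mem_univ _)
      (hasPartialAt_trigSeries (summable_coefficient_mul hκ hA i) i
        (summable_coefficient_mul_mul hκ hA i i) _ _)
  rw [h, h, h]
  simp only [trigSeries]
  rw [← neg_add, mul_neg, ← Summable.tsum_add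
    (summable_trigTerm (summable_coefficient_mul_mul hκ hA 1 1) _ _)
    (summable_trigTerm (summable_coefficient_mul_mul hκ hA 2 2) _ _), ← tsum_mul_left]
  congr 1
  refine tsum_congr fun k => ?_
  have hsq := Real.mul_self_sqrt (zero_le_one.trans (one_le_sq_add_sq k))
  have e0 : waveFrequency κ k 0 * waveFrequency κ k 0 =
      κ ^ 2 * (waveFrequency κ k 1 * waveFrequency κ k 1 +
        waveFrequency κ k 2 * waveFrequency κ k 2) := by
    simp only [waveFrequency, Matrix.cons_val_zero, Matrix.cons_val_one, Matrix.cons_val]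
    linear_combination (Real.pi * κ) ^ 2 * hsq
  rw [mul_assoc (A k.1 k.2), e0]
  ring

theorem hasFractalPartialAt_zero_seriesSolution {κ : ℝ} (hκ : 0 < κ) {A : ℕ+ → ℕ+ → ℝ}
    (hA : Summable fun k : ℕ+ × ℕ+ => ((k.1 : ℝ) ^ 2 + (k.2 : ℝ) ^ 2) * |A k.1 k.2|)
    {p : Fin 3 → ℝ} (hp : p 0 = 0) :
    HasFractalPartialAt 0 (seriesSolution κ A) 0 p := by
  rw [seriesSolution_eq, hasFractalPartialAt_comp_scaling]
  have h := hasPartialAt_trigSeries (summable_coefficient hA) 0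
    (summable_coefficient_mul hκ hA 0) wavePhase (scaling p)
  convert h using 1
  rw [trigSeries, eq_comm]
  convert tsum_zero with k
  have h0 : scaling p 0 = 0 := by
    rw [scaling_apply, hp]; exact staircase_self 0
  rw [Fin.prod_univ_three, h0, Function.update_self]
  simp [wavePhase]

theorem seriesSolution_eq_zero_of_edge (κ : ℝ) (A : ℕ+ → ℕ+ → ℝ) {p : Fin 3 → ℝ}
    (hp : p 1 = -1 / 3 ∨ p 1 = 4 / 3 ∨ p 2 = -1 / 3 ∨ p 2 = 4 / 3) :
    seriesSolution κ A p = 0 := by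
  have h0 : staircase (-1 / 3) (-1 / 3) = 0 := staircase_self _
  have h1 := staircase_edge
  have hsin : ∀ m : ℕ+, Real.sin (Real.pi * (m : ℝ)) = 0 := fun m => by
    rw [mul_comm]; exact_mod_cast Real.sin_nat_mul_pi m
  rw [seriesSolution]
  convert tsum_zero with k
  have e1 : scalingVar 1 = staircase (-1 / 3) := rfl
  have e2 : scalingVar 2 = staircase (-1 / 3) := rfl
  rw [seriesTerm, e1, e2]
  rcases hp with h | h | h | h <;> rw [h] <;> simp only [h0, h1, mul_one, mul_zero, Real.sin_zero,
    zero_mul, hsin]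

/-! ### Coefficients as Fourier sine coefficients on the unit square -/

/-- The point of the plane whose space coordinates have the scaling variables `q`. -/
noncomputable def unscale (q : ℝ × ℝ) : ℂ :=
  ⟨(staircaseHomeo (-1 / 3)).symm q.1, (staircaseHomeo (-1 / 3)).symm q.2⟩

theorem continuous_unscale : Continuous unscale := by
  have : unscale = fun q : ℝ × ℝ => ((staircaseHomeo (-1 / 3)).symm q.1 : ℂ) +
      ((staircaseHomeo (-1 / 3)).symm q.2 : ℂ) * Complex.I := by
    ext q; exact Complex.mk_eq_add_mul_I _ _
  rw [this]; fun_prop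

theorem unscale_staircase (x y : ℝ) :
    unscale (staircase (-1 / 3) x, staircase (-1 / 3) y) = ⟨x, y⟩ := by
  simp only [unscale, ← coe_staircaseHomeo, Homeomorph.symm_apply_apply]

theorem mem_unitSquare_of_unscale_mem {q : ℝ × ℝ} (hq : unscale q ∈ kochDomain) :
    q ∈ Set.Icc (0 : ℝ) 1 ×ˢ Set.Icc (0 : ℝ) 1 := by
  obtain ⟨⟨h1, h2⟩, h3, h4⟩ := kochDomain_subset_closedSquare hq
  have hm := (strictMono_staircase (-1 / 3)).monotone
  have e : ∀ t, staircase (-1 / 3) ((staircaseHomeo (-1 / 3)).symm t) = t :=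
    (staircaseHomeo (-1 / 3)).apply_symm_apply
  have a1 := hm h1
  have a2 := hm h2
  have a3 := hm h3
  have a4 := hm h4
  simp only [unscale, e, staircase_self, staircase_edge] at a1 a2 a3 a4
  exact ⟨⟨a1, a2⟩, a3, a4⟩

theorem fourierCoefficient_eq (h : ℂ → ℝ) (m n : ℕ+) :
    fourierCoefficient h m n = 4 * ∫ q : ℝ × ℝ, kochDomain.indicator h (unscale q) *
      Real.sin (Real.pi * (m : ℝ) * q.1) * Real.sin (Real.pi * (n : ℝ) * q.2) := by
  have hmp := (measurePreserving_staircase (-1 / 3)).prod (measurePreserving_staircase (-1 / 3))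
  have hemb : MeasurableEmbedding (Prod.map (staircase (-1 / 3)) (staircase (-1 / 3))) :=
    ((staircaseHomeo (-1 / 3)).prodCongr (staircaseHomeo (-1 / 3))).measurableEmbedding
  have hD : MeasurableSet (unscale ⁻¹' kochDomain) :=
    (isOpen_kochDomain.preimage continuous_unscale).measurableSet
  have hset := hmp.setIntegral_preimage_emb hemb (fun q => h (unscale q) *
    Real.sin (Real.pi * (m : ℝ) * q.1) * Real.sin (Real.pi * (n : ℝ) * q.2))
    (unscale ⁻¹' kochDomain)
  have hpre : Prod.map (staircase (-1 / 3)) (staircase (-1 / 3)) ⁻¹' (unscale ⁻¹' kochDomain) =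
      {q : ℝ × ℝ | (⟨q.1, q.2⟩ : ℂ) ∈ kochDomain} := by
    ext q
    simp only [Set.mem_preimage, Prod.map, unscale_staircase, Set.mem_ofPred_eq]
  rw [hpre] at hset
  simp only [Prod.map, unscale_staircase] at hset
  have e1 : scalingVar 1 = staircase (-1 / 3) := rfl
  have e2 : scalingVar 2 = staircase (-1 / 3) := rfl
  rw [fourierCoefficient, e1, e2, hset, ← Measure.volume_eq_prod, ← integral_indicator hD]
  congr 2
  ext q
  by_cases hq : unscale q ∈ kochDomain
  · rw [Set.indicator_of_mem (show q ∈ unscale ⁻¹' kochDomain from hq), Set.indicator_of_mem hq]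
  · rw [Set.indicator_of_notMem (show q ∉ unscale ⁻¹' kochDomain from hq),
      Set.indicator_of_notMem hq, zero_mul, zero_mul]

/-! ### Integration by parts and the decay of the coefficients -/

/-- A function on space-time that vanishes off the closed set `Z`, which lies over the unit
square of the space coordinates. -/
structure SupportedOver (Z : Set (Fin 3 → ℝ)) (G : (Fin 3 → ℝ) → ℝ) : Prop where
  isClosed : IsClosed Z
  subset : ∀ q ∈ Z, (q 1, q 2) ∈ Set.Icc (0 : ℝ) 1 ×ˢ Set.Icc (0 : ℝ) 1
  eq_zero : ∀ q ∉ Z, G q = 0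

theorem SupportedOver.partialDeriv {Z : Set (Fin 3 → ℝ)} {G G' : (Fin 3 → ℝ) → ℝ}
    (hG : SupportedOver Z G) (i : Fin 3) (h : ∀ q, HasPartialAt i G (G' q) q) :
    SupportedOver Z G' := by
  refine ⟨hG.isClosed, hG.subset, fun q hq => ?_⟩
  have h0 : HasPartialAt i (fun _ => (0 : ℝ)) 0 q := hasDerivAt_const _ _
  have h1 := h0.congr_of_eqOn hG.isClosed.isOpen_compl hq fun q hq => hG.eq_zero q hq
  exact (h q).unique h1

/-- The integral of the slice `q 0 = 0` of `G` against a product of two sines. -/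
noncomputable def sineIntegral (G : (Fin 3 → ℝ) → ℝ) (a b φ ψ : ℝ) : ℝ :=
  ∫ z : ℝ × ℝ, G ![0, z.1, z.2] * Real.sin (a * z.1 + φ) * Real.sin (b * z.2 + ψ)

theorem continuous_slice {G : (Fin 3 → ℝ) → ℝ} (hc : Continuous G) :
    Continuous fun z : ℝ × ℝ => G ![0, z.1, z.2] :=
  hc.comp (continuous_pi fun i => by fin_cases i <;> simp <;> fun_prop)

theorem SupportedOver.integrable_mul {Z : Set (Fin 3 → ℝ)} {G : (Fin 3 → ℝ) → ℝ}
    (hG : SupportedOver Z G) (hc : Continuous G) {f : ℝ × ℝ → ℝ} (hf : Continuous f) :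
    Integrable fun z : ℝ × ℝ => G ![0, z.1, z.2] * f z := by
  refine ((continuous_slice hc).mul hf).integrable_of_hasCompactSupport
    (HasCompactSupport.intro
      ((isCompact_Icc (a := (0 : ℝ)) (b := 1)).prod (isCompact_Icc (a := (0 : ℝ)) (b := 1)))
      fun z hz => ?_)
  rw [Pi.mul_apply, hG.eq_zero _ fun hZ => hz (by simpa using hG.subset _ hZ), zero_mul]

/-- One-dimensional integration by parts against a sine; the phase takes the sign. -/
theorem mul_integral_mul_sin {u u' : ℝ → ℝ} (hu : ∀ x, HasDerivAt u (u' x) x)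
    (hu' : Continuous u') {K : Set ℝ} (hK : IsCompact K) (h0 : ∀ x ∉ K, u x = 0)
    (h0' : ∀ x ∉ K, u' x = 0) (a φ : ℝ) :
    a * ∫ x, u x * Real.sin (a * x + φ) = ∫ x, u' x * Real.sin (a * x + (φ + Real.pi / 2)) := by
  have huc : Continuous u := continuous_iff_continuousAt.2 fun x => (hu x).continuousAt
  have hv : ∀ x, HasDerivAt (fun x => -Real.cos (a * x + φ)) (a * Real.sin (a * x + φ)) x := by
    intro x
    have := ((((hasDerivAt_id x).const_mul a).add_const φ).cos).neg
    exact this.congr_deriv (by simp; ring)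
  have hint : ∀ {f g : ℝ → ℝ}, Continuous f → Continuous g → (∀ x ∉ K, f x = 0) →
      Integrable (f * g) := fun hf hg hz =>
    (hf.mul hg).integrable_of_hasCompactSupport (HasCompactSupport.intro hK fun x hx => by
      rw [Pi.mul_apply, hz x hx, zero_mul])
  have h := integral_mul_deriv_eq_deriv_mul_of_integrable (fun x _ => hu x) (fun x _ => hv x)
    (hint huc (by fun_prop) h0) (hint hu' (by fun_prop) h0') (hint huc (by fun_prop) h0)
  rw [← integral_const_mul]
  calc _ = ∫ x, u x * (a * Real.sin (a * x + φ)) := by congr 1; ext x; ring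
    _ = _ := by
      rw [h, ← integral_neg]
      congr 1
      ext x
      rw [← add_assoc, Real.sin_add_pi_div_two]; ring

theorem mul_sineIntegral_x {Z : Set (Fin 3 → ℝ)} {G G' : (Fin 3 → ℝ) → ℝ}
    (hG : SupportedOver Z G) (hc : Continuous G) (hc' : Continuous G')
    (h : ∀ q, HasPartialAt 1 G (G' q) q) (a b φ ψ : ℝ) :
    a * sineIntegral G a b φ ψ = sineIntegral G' a b (φ + Real.pi / 2) ψ := by
  have hG' := hG.partialDeriv 1 h
  have hi1 := hG.integrable_mul hc (f := fun z => Real.sin (a * z.1 + φ) * Real.sin (b * z.2 + ψ))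
    (by fun_prop)
  have hi2 := hG'.integrable_mul hc' (f := fun z => Real.sin (a * z.1 + (φ + Real.pi / 2)) *
    Real.sin (b * z.2 + ψ)) (by fun_prop)
  simp only [sineIntegral, mul_assoc]
  rw [Measure.volume_eq_prod] at hi1 hi2 ⊢
  rw [integral_prod_symm _ hi1, integral_prod_symm _ hi2, ← integral_const_mul]
  congr 1
  ext y
  simp only [← mul_assoc, integral_mul_const]
  congr 1
  refine mul_integral_mul_sin (K := Set.Icc 0 1) (fun x => ?_) ?_ isCompact_Icc (fun x hx => ?_)
    (fun x hx => ?_) a φ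
  · have := h ![0, x, y]
    rw [HasPartialAt] at this
    have hs : ∀ s, Function.update ![0, x, y] 1 s = ![0, s, y] := fun s => by
      ext j; fin_cases j <;> simp
    simp only [hs] at this
    exact this
  · exact (continuous_slice hc').comp (f := fun x => (x, y)) (by fun_prop)
  · exact hG.eq_zero _ fun hZ => hx (hG.subset _ hZ).1
  · exact hG'.eq_zero _ fun hZ => hx (hG.subset _ hZ).1

theorem mul_sineIntegral_y {Z : Set (Fin 3 → ℝ)} {G G' : (Fin 3 → ℝ) → ℝ}
    (hG : SupportedOver Z G) (hc : Continuous G) (hc' : Continuous G')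
    (h : ∀ q, HasPartialAt 2 G (G' q) q) (a b φ ψ : ℝ) :
    b * sineIntegral G a b φ ψ = sineIntegral G' a b φ (ψ + Real.pi / 2) := by
  have hG' := hG.partialDeriv 2 h
  have hi1 := hG.integrable_mul hc (f := fun z => Real.sin (a * z.1 + φ) * Real.sin (b * z.2 + ψ))
    (by fun_prop)
  have hi2 := hG'.integrable_mul hc' (f := fun z => Real.sin (a * z.1 + φ) *
    Real.sin (b * z.2 + (ψ + Real.pi / 2))) (by fun_prop)
  simp only [sineIntegral, mul_assoc]
  rw [Measure.volume_eq_prod] at hi1 hi2 ⊢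
  rw [integral_prod _ hi1, integral_prod _ hi2, ← integral_const_mul]
  congr 1
  ext x
  simp only [mul_left_comm _ (Real.sin (a * x + φ)), integral_const_mul]
  congr 1
  refine mul_integral_mul_sin (K := Set.Icc 0 1) (fun y => ?_) ?_ isCompact_Icc (fun y hy => ?_)
    (fun y hy => ?_) b ψ
  · have := h ![0, x, y]
    rw [HasPartialAt] at this
    have hs : ∀ s, Function.update ![0, x, y] 2 s = ![0, x, s] := fun s => by
      ext j; fin_cases j <;> simp
    simp only [hs] at this
    exact this
  · exact (continuous_slice hc').comp (f := fun y => (x, y)) (by fun_prop)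
  · exact hG.eq_zero _ fun hZ => hy (hG.subset _ hZ).2
  · exact hG'.eq_zero _ fun hZ => hy (hG.subset _ hZ).2

/-- Every derivative in `x` gains a factor `a`, every derivative in `y` a factor `b`. -/
theorem exists_bound_sineIntegral (j l : ℕ) {Z : Set (Fin 3 → ℝ)} {G : (Fin 3 → ℝ) → ℝ}
    (hG : SupportedOver Z G) (hd : PartialContDiffOn (j + l) G Set.univ) :
    ∃ C, ∀ a b φ ψ, |a ^ j * b ^ l * sineIntegral G a b φ ψ| ≤ C := by
  induction j generalizing G with
  | succ j ih =>
    rw [show j + 1 + l = (j + l) + 1 by ring] at hd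
    obtain ⟨hc, hd⟩ := hd
    obtain ⟨G', h1, h2⟩ := hd 1
    have hc' : Continuous G' := by
      rw [← continuousOn_univ]
      cases hn : j + l with
      | zero => rw [hn] at h2; exact h2
      | succ n => rw [hn] at h2; exact h2.1
    obtain ⟨C, hC⟩ := ih (hG.partialDeriv 1 fun q => h1 q trivial) h2
    refine ⟨C, fun a b φ ψ => ?_⟩
    rw [show a ^ (j + 1) * b ^ l * sineIntegral G a b φ ψ =
      a ^ j * b ^ l * (a * sineIntegral G a b φ ψ) by ring,
      mul_sineIntegral_x hG (continuousOn_univ.1 hc) hc' fun q => h1 q trivial]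
    exact hC _ _ _ _
  | zero =>
    induction l generalizing G with
    | succ l ih =>
      rw [show 0 + (l + 1) = (0 + l) + 1 by ring] at hd
      obtain ⟨hc, hd⟩ := hd
      obtain ⟨G', h1, h2⟩ := hd 2
      have hc' : Continuous G' := by
        rw [← continuousOn_univ]
        cases hn : 0 + l with
        | zero => rw [hn] at h2; exact h2
        | succ n => rw [hn] at h2; exact h2.1
      obtain ⟨C, hC⟩ := ih (hG.partialDeriv 2 fun q => h1 q trivial) h2
      refine ⟨C, fun a b φ ψ => ?_⟩
      rw [show a ^ 0 * b ^ (l + 1) * sineIntegral G a b φ ψ =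
        a ^ 0 * b ^ l * (b * sineIntegral G a b φ ψ) by ring,
        mul_sineIntegral_y hG (continuousOn_univ.1 hc) hc' fun q => h1 q trivial]
      exact hC _ _ _ _
    | zero =>
      refine ⟨∫ z : ℝ × ℝ, |G ![0, z.1, z.2]|, fun a b φ ψ => ?_⟩
      rw [pow_zero, pow_zero, one_mul, one_mul, ← Real.norm_eq_abs]
      have hint := hG.integrable_mul (continuousOn_univ.1 hd) (f := fun _ => 1) continuous_const
      simp only [mul_one] at hint
      refine norm_integral_le_of_norm_le hint.norm (ae_of_all _ fun z => ?_)
      rw [norm_mul, norm_mul, mul_assoc]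
      exact mul_le_of_le_one_right (norm_nonneg _) (mul_le_one₀ (Real.abs_sin_le_one _)
        (norm_nonneg _) (Real.abs_sin_le_one _))

/-- The geometric means of the two pairs of bounds are summable with the weights `m²` and `n²`. -/
theorem summable_of_decay {A : ℕ+ × ℕ+ → ℝ} {C : ℝ}
    (h32 : ∀ k : ℕ+ × ℕ+, (k.1 : ℝ) ^ 3 * (k.2 : ℝ) ^ 2 * |A k| ≤ C)
    (h41 : ∀ k : ℕ+ × ℕ+, (k.1 : ℝ) ^ 4 * (k.2 : ℝ) ^ 1 * |A k| ≤ C)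
    (h23 : ∀ k : ℕ+ × ℕ+, (k.1 : ℝ) ^ 2 * (k.2 : ℝ) ^ 3 * |A k| ≤ C)
    (h14 : ∀ k : ℕ+ × ℕ+, (k.1 : ℝ) ^ 1 * (k.2 : ℝ) ^ 4 * |A k| ≤ C) :
    Summable fun k : ℕ+ × ℕ+ => ((k.1 : ℝ) ^ 2 + (k.2 : ℝ) ^ 2) * |A k| := by
  set s : ℕ+ → ℝ := fun m => 1 / (m : ℝ) ^ (3 / 2 : ℝ) with hs
  have hs0 : ∀ m, 0 ≤ s m := fun m => by positivity
  have hs2 : ∀ m : ℕ+, s m ^ 2 = 1 / (m : ℝ) ^ 3 := fun m => by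
    rw [hs]
    simp only [div_pow, one_pow]
    rw [← Real.rpow_natCast, ← Real.rpow_mul (by positivity)]
    norm_num
  have hsum : Summable s := by
    have h1 : Summable fun n : ℕ => 1 / (n : ℝ) ^ (3 / 2 : ℝ) :=
      Real.summable_one_div_nat_rpow.2 (by norm_num)
    exact h1.comp_injective (i := fun m : ℕ+ => (m : ℕ)) PNat.coe_injective
  have hC : 0 ≤ C := le_trans (by positivity) (h32 (1, 1))
  have hprod : Summable fun k : ℕ+ × ℕ+ => C * (s k.1 * s k.2) :=
    (hsum.mul_of_nonneg hsum hs0 hs0).mul_left C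
  have key : ∀ (k : ℕ+ × ℕ+) (t : ℝ), 0 ≤ t →
      t ^ 2 * ((k.1 : ℝ) ^ 3 * (k.2 : ℝ) ^ 3) ≤ C ^ 2 → t ≤ C * (s k.1 * s k.2) := by
    intro k t ht h
    refine le_of_sq_le_sq ?_ (mul_nonneg hC (mul_nonneg (hs0 _) (hs0 _)))
    rw [mul_pow, mul_pow, hs2, hs2, one_div_mul_one_div, mul_one_div, le_div_iff₀ (by positivity)]
    exact h
  refine Summable.of_nonneg_of_le (fun k => by positivity) (fun k => ?_) (hprod.add hprod)
  rw [add_mul]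
  refine add_le_add (key k _ (by positivity) ?_) (key k _ (by positivity) ?_)
  · calc ((k.1 : ℝ) ^ 2 * |A k|) ^ 2 * ((k.1 : ℝ) ^ 3 * (k.2 : ℝ) ^ 3)
        = ((k.1 : ℝ) ^ 3 * (k.2 : ℝ) ^ 2 * |A k|) * ((k.1 : ℝ) ^ 4 * (k.2 : ℝ) ^ 1 * |A k|) := by
          ring
      _ ≤ C * C := mul_le_mul (h32 k) (h41 k) (by positivity) hC
      _ = C ^ 2 := by ring
  · calc ((k.2 : ℝ) ^ 2 * |A k|) ^ 2 * ((k.1 : ℝ) ^ 3 * (k.2 : ℝ) ^ 3)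
        = ((k.1 : ℝ) ^ 2 * (k.2 : ℝ) ^ 3 * |A k|) * ((k.1 : ℝ) ^ 1 * (k.2 : ℝ) ^ 4 * |A k|) := by
          ring
      _ ≤ C * C := mul_le_mul (h23 k) (h14 k) (by positivity) hC
      _ = C ^ 2 := by ring

theorem summable_fourierCoefficient {h : ℂ → ℝ} (hsupp : tsupport h ⊆ kochDomain)
    (hd : FractalContDiffOn 5 (fun p => h ⟨p 1, p 2⟩) Set.univ) :
    Summable fun k : ℕ+ × ℕ+ =>
      ((k.1 : ℝ) ^ 2 + (k.2 : ℝ) ^ 2) * |fourierCoefficient h k.1 k.2| := by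
  set G : (Fin 3 → ℝ) → ℝ := fun q => h (unscale (q 1, q 2)) with hGdef
  set Z : Set (Fin 3 → ℝ) := (fun q => unscale (q 1, q 2)) ⁻¹' tsupport h with hZ
  have hG : SupportedOver Z G := by
    refine ⟨(isClosed_tsupport h).preimage (continuous_unscale.comp (by fun_prop)),
      fun q hq => mem_unitSquare_of_unscale_mem (hsupp hq), fun q hq => ?_⟩
    exact image_eq_zero_of_notMem_tsupport (f := h) hq
  have hP : PartialContDiffOn 5 G Set.univ := by
    rw [← fractalContDiffOn_comp_scaling]
    rw [Set.preimage_univ]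
    convert hd using 1
    ext p
    have e1 : scalingVar 1 = staircase (-1 / 3) := rfl
    have e2 : scalingVar 2 = staircase (-1 / 3) := rfl
    simp only [hGdef, scaling_apply, e1, e2, unscale_staircase]
  have hcoef : ∀ m n : ℕ+, fourierCoefficient h m n =
      4 * sineIntegral G (Real.pi * m) (Real.pi * n) 0 0 := fun m n => by
    rw [fourierCoefficient_eq, sineIntegral]
    have hind : kochDomain.indicator h = h := by
      rw [Set.indicator_eq_self]
      exact (subset_tsupport h).trans hsupp
    simp [hind, hGdef]
  have hbound : ∀ j l : ℕ, j + l = 5 → ∃ C, ∀ k : ℕ+ × ℕ+,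
      (k.1 : ℝ) ^ j * (k.2 : ℝ) ^ l * |fourierCoefficient h k.1 k.2| ≤ C := by
    intro j l hjl
    obtain ⟨C, hC⟩ := exists_bound_sineIntegral j l hG (hjl ▸ hP)
    refine ⟨4 * C, fun k => ?_⟩
    have h1 := hC (Real.pi * k.1) (Real.pi * k.2) 0 0
    rw [hcoef, abs_mul, abs_of_pos (show (0 : ℝ) < 4 by norm_num)]
    have hπ : (1 : ℝ) ≤ Real.pi := by linarith [Real.pi_gt_three]
    rw [abs_mul, abs_of_nonneg (by positivity)] at h1
    have h2 : (k.1 : ℝ) ^ j * (k.2 : ℝ) ^ l ≤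
        (Real.pi * (k.1 : ℝ)) ^ j * (Real.pi * (k.2 : ℝ)) ^ l := by
      gcongr
      · exact le_mul_of_one_le_left (by positivity) hπ
      · exact le_mul_of_one_le_left (by positivity) hπ
    nlinarith [mul_le_mul_of_nonneg_right h2
      (abs_nonneg (sineIntegral G (Real.pi * k.1) (Real.pi * k.2) 0 0))]
  obtain ⟨C1, h1⟩ := hbound 3 2 rfl
  obtain ⟨C2, h2⟩ := hbound 4 1 rfl
  obtain ⟨C3, h3⟩ := hbound 2 3 rfl
  obtain ⟨C4, h4⟩ := hbound 1 4 rfl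
  refine summable_of_decay (A := fun k => fourierCoefficient h k.1 k.2)
    (C := max (max C1 C2) (max C3 C4)) (fun k => (h1 k).trans ?_) (fun k => (h2 k).trans ?_)
    (fun k => (h3 k).trans ?_) (fun k => (h4 k).trans ?_) <;> simp

/-! ### Completeness of the sine products and the initial values -/

/-- The closed unit square, in the scaling variables. -/
abbrev unitSquare : Set (ℝ × ℝ) := Set.Icc (0 : ℝ) 1 ×ˢ Set.Icc (0 : ℝ) 1

/-- `sin (π m x)` as a continuous function on the square. -/
noncomputable def sineX (m : ℕ) : C(unitSquare, ℝ) :=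
  ⟨fun q => Real.sin (Real.pi * m * q.1.1), by fun_prop⟩

/-- `sin (π n y)` as a continuous function on the square. -/
noncomputable def sineY (n : ℕ) : C(unitSquare, ℝ) :=
  ⟨fun q => Real.sin (Real.pi * n * q.1.2), by fun_prop⟩

/-- `cos (π x)` as a continuous function on the square. -/
noncomputable def cosineX : C(unitSquare, ℝ) :=
  ⟨fun q => Real.cos (Real.pi * q.1.1), by fun_prop⟩

/-- `cos (π y)` as a continuous function on the square. -/
noncomputable def cosineY : C(unitSquare, ℝ) :=
  ⟨fun q => Real.cos (Real.pi * q.1.2), by fun_prop⟩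

theorem isCompact_unitSquare : IsCompact unitSquare := isCompact_Icc.prod isCompact_Icc

instance : CompactSpace unitSquare := isCompact_iff_compactSpace.1 isCompact_unitSquare

theorem integrable_continuousMap (μ : Measure unitSquare) [IsFiniteMeasure μ]
    (f : C(unitSquare, ℝ)) : Integrable f μ :=
  f.continuous.integrable_of_hasCompactSupport (HasCompactSupport.of_compactSpace f)

/-- All sine coefficients of `E` vanish. -/
def SineOrthogonal (μ : Measure unitSquare) (E : C(unitSquare, ℝ)) : Prop :=
  ∀ m n : ℕ, ∫ q, (E * sineX m * sineY n) q ∂μ = 0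

theorem SineOrthogonal.smul {μ : Measure unitSquare} {E : C(unitSquare, ℝ)}
    (h : SineOrthogonal μ E) (c : ℝ) : SineOrthogonal μ (c • E) := fun m n => by
  have := h m n
  simp only [ContinuousMap.mul_apply, ContinuousMap.smul_apply, smul_eq_mul, mul_assoc] at this ⊢
  rw [integral_const_mul, this, mul_zero]

theorem SineOrthogonal.add {μ : Measure unitSquare} [IsFiniteMeasure μ] {E F : C(unitSquare, ℝ)}
    (hE : SineOrthogonal μ E) (hF : SineOrthogonal μ F) : SineOrthogonal μ (E + F) := fun m n => by
  have h : ∀ q, ((E + F) * sineX m * sineY n) q =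
      (E * sineX m * sineY n) q + (F * sineX m * sineY n) q := fun q => by simp; ring
  simp only [h]
  rw [integral_add (integrable_continuousMap μ _) (integrable_continuousMap μ _), hE m n, hF m n,
    add_zero]

theorem cos_mul_sin_succ (m : ℕ) (x : ℝ) :
    Real.cos (Real.pi * x) * Real.sin (Real.pi * (m + 1 : ℕ) * x) =
      1 / 2 * (Real.sin (Real.pi * (m + 2 : ℕ) * x) + Real.sin (Real.pi * m * x)) := by
  have h1 : Real.pi * (m + 2 : ℕ) * x = Real.pi * (m + 1 : ℕ) * x + Real.pi * x := by
    push_cast; ring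
  have h2 : Real.pi * m * x = Real.pi * (m + 1 : ℕ) * x - Real.pi * x := by
    push_cast; ring
  rw [h1, h2, Real.sin_add, Real.sin_sub]; ring

theorem SineOrthogonal.mul_cosineX {μ : Measure unitSquare} [IsFiniteMeasure μ]
    {E : C(unitSquare, ℝ)} (h : SineOrthogonal μ E) : SineOrthogonal μ (E * cosineX) := by
  rintro (_ | m) n
  · simp [sineX]
  · have e : ∀ q, (E * cosineX * sineX (m + 1) * sineY n) q =
        1 / 2 * ((E * sineX (m + 2) * sineY n) q + (E * sineX m * sineY n) q) := fun q => by
      have := cos_mul_sin_succ m q.1.1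
      simp only [ContinuousMap.mul_apply, sineX, sineY, cosineX, ContinuousMap.coe_mk]
      linear_combination (E q * Real.sin (Real.pi * n * q.1.2)) * this
    simp only [e]
    rw [integral_const_mul, integral_add (integrable_continuousMap μ _)
      (integrable_continuousMap μ _), h, h, add_zero, mul_zero]

theorem SineOrthogonal.mul_cosineY {μ : Measure unitSquare} [IsFiniteMeasure μ]
    {E : C(unitSquare, ℝ)} (h : SineOrthogonal μ E) : SineOrthogonal μ (E * cosineY) := by
  rintro m (_ | n)
  · simp [sineY]
  · have e : ∀ q, (E * cosineY * sineX m * sineY (n + 1)) q =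
        1 / 2 * ((E * sineX m * sineY (n + 2)) q + (E * sineX m * sineY n) q) := fun q => by
      have := cos_mul_sin_succ n q.1.2
      simp only [ContinuousMap.mul_apply, sineX, sineY, cosineY, ContinuousMap.coe_mk]
      linear_combination (E q * Real.sin (Real.pi * m * q.1.1)) * this
    simp only [e]
    rw [integral_const_mul, integral_add (integrable_continuousMap μ _)
      (integrable_continuousMap μ _), h, h, add_zero, mul_zero]

/-- Multiplication by a polynomial in the two cosines preserves orthogonality to the sines. -/
theorem SineOrthogonal.mul_mem_adjoin {μ : Measure unitSquare} [IsFiniteMeasure μ]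
    {f : C(unitSquare, ℝ)} (hf : f ∈ Algebra.adjoin ℝ {cosineX, cosineY}) :
    ∀ {E : C(unitSquare, ℝ)}, SineOrthogonal μ E → SineOrthogonal μ (E * f) := by
  induction hf using Algebra.adjoin_induction with
  | mem f hf =>
    intro E hE
    rcases hf with rfl | rfl
    · exact hE.mul_cosineX
    · exact hE.mul_cosineY
  | algebraMap r =>
    intro E hE
    rw [mul_comm, ← Algebra.smul_def]
    exact hE.smul r
  | add f g _ _ hf hg =>
    intro E hE
    rw [mul_add]
    exact (hf hE).add (hg hE)
  | mul f g _ _ hf hg =>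
    intro E hE
    rw [← mul_assoc]
    exact hg (hf hE)

theorem adjoin_cosine_separatesPoints :
    (Algebra.adjoin ℝ {cosineX, cosineY}).SeparatesPoints := by
  intro q q' hqq
  have hinj : ∀ {x y : ℝ}, x ∈ Set.Icc (0 : ℝ) 1 → y ∈ Set.Icc (0 : ℝ) 1 →
      Real.cos (Real.pi * x) = Real.cos (Real.pi * y) → x = y := by
    intro x y hx hy h
    have hπ := Real.pi_pos
    have := Real.injOn_cos ⟨mul_nonneg hπ.le hx.1, mul_le_of_le_one_right hπ.le hx.2⟩
      ⟨mul_nonneg hπ.le hy.1, mul_le_of_le_one_right hπ.le hy.2⟩ h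
    exact mul_left_cancel₀ hπ.ne' this
  by_cases h : Real.cos (Real.pi * q.1.1) = Real.cos (Real.pi * q'.1.1)
  · refine ⟨_, ⟨cosineY, Algebra.subset_adjoin (by simp), rfl⟩, fun h' => hqq ?_⟩
    exact Subtype.ext (Prod.ext (hinj q.2.1 q'.2.1 h) (hinj q.2.2 q'.2.2 h'))
  · exact ⟨_, ⟨cosineX, Algebra.subset_adjoin (by simp), rfl⟩, h⟩

/-- By the Stone–Weierstrass theorem `F = E sin(π x) sin(π y)` is a uniform limit of polynomials in
the cosines, to which it is orthogonal. -/
theorem SineOrthogonal.integral_sq_eq_zero {μ : Measure unitSquare} [IsFiniteMeasure μ]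
    {E : C(unitSquare, ℝ)} (hE : SineOrthogonal μ E) :
    ∫ q, (E * sineX 1 * sineY 1) q ^ 2 ∂μ = 0 := by
  set F := E * sineX 1 * sineY 1 with hF
  set I := ∫ q, |F q| ∂μ
  have hI : 0 ≤ I := integral_nonneg fun q => abs_nonneg _
  have hle : ∀ ε > 0, ∫ q, F q ^ 2 ∂μ ≤ ε * I := by
    intro ε hε
    obtain ⟨⟨g, hg⟩, hgF⟩ :=
      ContinuousMap.exists_mem_subalgebra_near_continuousMap_of_separatesPoints _
        adjoin_cosine_separatesPoints F ε hε
    have h0 : ∫ q, F q * g q ∂μ = 0 := by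
      have := SineOrthogonal.mul_mem_adjoin hg hE 1 1
      rw [← this]
      congr 1
      ext q
      simp only [hF, ContinuousMap.mul_apply]; ring
    have h1 : ∫ q, F q ^ 2 ∂μ = ∫ q, F q * (F - g) q ∂μ := by
      have e : ∀ q, F q * (F - g) q = F q ^ 2 - F q * g q := fun q => by
        simp only [ContinuousMap.sub_apply]; ring
      simp only [e]
      have hs := integral_sub (f := fun q => F q ^ 2) (g := fun q => F q * g q)
        (integrable_continuousMap μ (F ^ 2)) (integrable_continuousMap μ (F * g))
      rw [hs, h0, sub_zero]
    rw [h1, ← integral_const_mul]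
    refine integral_mono (integrable_continuousMap μ (F * (F - g)))
      ((integrable_continuousMap μ F).abs.const_mul ε) fun q => ?_
    have h2 : |(F - g) q| ≤ ε := by
      have := (F - g).norm_coe_le_norm q
      rw [Real.norm_eq_abs, norm_sub_rev] at this
      exact this.trans hgF.le
    calc F q * (F - g) q ≤ |F q| * |(F - g) q| := by rw [← abs_mul]; exact le_abs_self _
      _ ≤ |F q| * ε := by gcongr
      _ = ε * |F q| := mul_comm _ _
  refine le_antisymm (le_of_forall_pos_le_add fun ε hε => ?_)
    (integral_nonneg fun q => sq_nonneg _)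
  refine (hle (ε / (I + 1)) (by positivity)).trans ?_
  rw [zero_add, div_mul_eq_mul_div, div_le_iff₀ (by positivity)]
  nlinarith

/-- A continuous function on the unit square with vanishing sine coefficients vanishes. -/
theorem eq_zero_of_sine_coefficients {E : ℝ × ℝ → ℝ} (hE : Continuous E)
    (h : ∀ m n : ℕ+, ∫ q in unitSquare, E q * Real.sin (Real.pi * (m : ℝ) * q.1) *
      Real.sin (Real.pi * (n : ℝ) * q.2) = 0) {q : ℝ × ℝ} (hq : q ∈ unitSquare) : E q = 0 := by
  have hmeas : MeasurableSet unitSquare := measurableSet_Icc.prod measurableSet_Icc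
  let μ : Measure unitSquare := Measure.comap Subtype.val volume
  have : IsFiniteMeasure μ := ⟨by
    rw [Measure.comap_apply _ Subtype.val_injective (fun s hs =>
      (MeasurableEmbedding.subtype_coe hmeas).measurableSet_image.2 hs) _ MeasurableSet.univ]
    rw [Set.image_univ, Subtype.range_coe]
    exact isCompact_unitSquare.measure_lt_top⟩
  let E' : C(unitSquare, ℝ) := ⟨fun q => E q, by fun_prop⟩
  have horth : SineOrthogonal μ E' := by
    intro m n
    rcases Nat.eq_zero_or_pos m with rfl | hm
    · simp [sineX]
    rcases Nat.eq_zero_or_pos n with rfl | hn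
    · simp [sineY]
    rw [← h ⟨m, hm⟩ ⟨n, hn⟩]
    exact integral_subtype_comap hmeas fun q : ℝ × ℝ => E q * Real.sin (Real.pi * (m : ℝ) * q.1) *
      Real.sin (Real.pi * (n : ℝ) * q.2)
  set F : ℝ × ℝ → ℝ := fun q => E q * Real.sin (Real.pi * (1 : ℕ) * q.1) *
    Real.sin (Real.pi * (1 : ℕ) * q.2) with hF
  have hFc : Continuous F := by fun_prop
  have hsq : ∫ q in unitSquare, F q ^ 2 = 0 := by
    rw [← horth.integral_sq_eq_zero]
    exact (integral_subtype_comap hmeas fun q : ℝ × ℝ => F q ^ 2).symm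
  have hae : F =ᵐ[volume.restrict unitSquare] 0 := by
    have := (setIntegral_eq_zero_iff_of_nonneg_ae (ae_of_all _ fun q => sq_nonneg (F q))
      ((hFc.pow 2).continuousOn.integrableOn_compact isCompact_unitSquare)).1 hsq
    filter_upwards [this] with q hq
    simpa using hq
  set U : Set (ℝ × ℝ) := Set.Ioo (0 : ℝ) 1 ×ˢ Set.Ioo (0 : ℝ) 1
  have hU : IsOpen U := isOpen_Ioo.prod isOpen_Ioo
  have hsub : U ⊆ unitSquare := Set.prod_mono Set.Ioo_subset_Icc_self Set.Ioo_subset_Icc_self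
  have hFU : Set.EqOn F 0 U := Measure.eqOn_open_of_ae_eq
    (ae_restrict_of_ae_restrict_of_subset hsub hae) hU hFc.continuousOn continuousOn_const
  have hEU : Set.EqOn E 0 U := by
    intro q hq
    have hs : ∀ {x : ℝ}, x ∈ Set.Ioo (0 : ℝ) 1 → Real.sin (Real.pi * (1 : ℕ) * x) ≠ 0 := fun hx =>
      (Real.sin_pos_of_pos_of_lt_pi (by have := Real.pi_pos; have := hx.1; simp; positivity) (by
        simpa using mul_lt_of_lt_one_right Real.pi_pos hx.2)).ne'
    have := hFU hq
    simpa [hF, -Nat.cast_one, hs hq.1, hs hq.2] using this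
  have hcl : closure U = unitSquare := by
    rw [closure_prod_eq, closure_Ioo zero_ne_one]
  rw [← hcl] at hq
  exact hEU.closure hE continuous_const hq

theorem integral_sin_mul_sin (k m : ℕ+) :
    ∫ x in Set.Icc (0 : ℝ) 1, Real.sin (Real.pi * (k : ℝ) * x) * Real.sin (Real.pi * (m : ℝ) * x) =
      if k = m then 1 / 2 else 0 := by
  have hcos : ∀ j : ℤ, j ≠ 0 → ∫ x in (0 : ℝ)..1, Real.cos (Real.pi * j * x) = 0 := by
    intro j hj
    have hj' : Real.pi * (j : ℝ) ≠ 0 := mul_ne_zero Real.pi_ne_zero (by exact_mod_cast hj)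
    rw [intervalIntegral.integral_comp_mul_left _ hj', integral_cos, mul_zero, mul_one,
      Real.sin_zero, mul_comm Real.pi, Real.sin_int_mul_pi]
    simp
  have hprod : ∀ x : ℝ, Real.sin (Real.pi * (k : ℝ) * x) * Real.sin (Real.pi * (m : ℝ) * x) =
      1 / 2 * (Real.cos (Real.pi * ((k - m : ℤ) : ℝ) * x) -
        Real.cos (Real.pi * ((k + m : ℤ) : ℝ) * x)) := by
    intro x
    have h1 : Real.pi * ((k - m : ℤ) : ℝ) * x =
      Real.pi * (k : ℝ) * x - Real.pi * (m : ℝ) * x := by push_cast; ring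
    have h2 : Real.pi * ((k + m : ℤ) : ℝ) * x =
      Real.pi * (k : ℝ) * x + Real.pi * (m : ℝ) * x := by push_cast; ring
    rw [h1, h2, Real.cos_sub, Real.cos_add]; ring
  rw [integral_Icc_eq_integral_Ioc, ← intervalIntegral.integral_of_le zero_le_one]
  simp only [hprod]
  have hc : ∀ a : ℝ, IntervalIntegrable (fun x => Real.cos (a * x)) volume 0 1 := fun a =>
    Continuous.intervalIntegrable (by fun_prop) _ _
  rw [intervalIntegral.integral_const_mul, intervalIntegral.integral_sub (hc _) (hc _),
    hcos (k + m) (by have := k.pos; have := m.pos; omega)]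
  split_ifs with h
  · subst h; simp
  · rw [hcos (k - m) (by
      intro h0
      exact h (PNat.coe_injective (by omega)))]
    simp

theorem integral_sine_products (k l : ℕ+ × ℕ+) :
    ∫ q in unitSquare, Real.sin (Real.pi * (k.1 : ℝ) * q.1) * Real.sin (Real.pi * (k.2 : ℝ) * q.2) *
      Real.sin (Real.pi * (l.1 : ℝ) * q.1) * Real.sin (Real.pi * (l.2 : ℝ) * q.2) =
      if k = l then 1 / 4 else 0 := by
  have h := setIntegral_prod_mul (μ := (volume : Measure ℝ)) (ν := (volume : Measure ℝ))
    (fun x => Real.sin (Real.pi * (k.1 : ℝ) * x) * Real.sin (Real.pi * (l.1 : ℝ) * x))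
    (fun y => Real.sin (Real.pi * (k.2 : ℝ) * y) * Real.sin (Real.pi * (l.2 : ℝ) * y))
    (Set.Icc 0 1) (Set.Icc 0 1)
  rw [integral_sin_mul_sin, integral_sin_mul_sin, ← Measure.volume_eq_prod] at h
  have e : ∀ q : ℝ × ℝ, Real.sin (Real.pi * (k.1 : ℝ) * q.1) *
      Real.sin (Real.pi * (k.2 : ℝ) * q.2) * Real.sin (Real.pi * (l.1 : ℝ) * q.1) *
      Real.sin (Real.pi * (l.2 : ℝ) * q.2) =
      (Real.sin (Real.pi * (k.1 : ℝ) * q.1) * Real.sin (Real.pi * (l.1 : ℝ) * q.1)) *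
      (Real.sin (Real.pi * (k.2 : ℝ) * q.2) * Real.sin (Real.pi * (l.2 : ℝ) * q.2)) :=
    fun q => by ring
  simp only [e]
  rw [h]
  by_cases h1 : k.1 = l.1 <;> by_cases h2 : k.2 = l.2 <;> simp [h1, h2, Prod.ext_iff]
  norm_num

/-- The sine coefficients of an absolutely convergent double sine series. -/
theorem integral_tsum_sine_products {B : ℕ+ × ℕ+ → ℝ} (hB : Summable fun k => |B k|)
    (l : ℕ+ × ℕ+) :
    ∫ q in unitSquare, (∑' k : ℕ+ × ℕ+, B k * (Real.sin (Real.pi * (k.1 : ℝ) * q.1) *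
      Real.sin (Real.pi * (k.2 : ℝ) * q.2))) * Real.sin (Real.pi * (l.1 : ℝ) * q.1) *
      Real.sin (Real.pi * (l.2 : ℝ) * q.2) = B l / 4 := by
  set F : ℕ+ × ℕ+ → ℝ × ℝ → ℝ := fun k q => B k * (Real.sin (Real.pi * (k.1 : ℝ) * q.1) *
      Real.sin (Real.pi * (k.2 : ℝ) * q.2) * Real.sin (Real.pi * (l.1 : ℝ) * q.1) *
      Real.sin (Real.pi * (l.2 : ℝ) * q.2)) with hF
  have hFb : ∀ k q, ‖F k q‖ ≤ |B k| := fun k q => by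
    rw [hF]
    simp only [norm_mul]
    refine mul_le_of_le_one_right (abs_nonneg _) ?_
    have hs : ∀ t : ℝ, ‖Real.sin t‖ ≤ 1 := Real.abs_sin_le_one
    exact mul_le_one₀ (mul_le_one₀ (mul_le_one₀ (hs _) (norm_nonneg _) (hs _)) (norm_nonneg _)
      (hs _)) (norm_nonneg _) (hs _)
  have hvol : volume.real unitSquare = 1 := by
    rw [Measure.real, Measure.volume_eq_prod, Measure.prod_prod, Real.volume_Icc]; simp
  have hfin : IsFiniteMeasure (volume.restrict unitSquare) :=
    isFiniteMeasure_restrict.2 isCompact_unitSquare.measure_lt_top.ne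
  have hint : ∀ k, Integrable (F k) (volume.restrict unitSquare) := fun k =>
    (Continuous.continuousOn (by fun_prop)).integrableOn_compact isCompact_unitSquare
  have hsum : Summable fun k => ∫ q in unitSquare, ‖F k q‖ := by
    refine Summable.of_nonneg_of_le (fun k => integral_nonneg fun q => norm_nonneg _)
      (fun k => ?_) hB
    refine (integral_mono (hint k).norm (integrable_const |B k|) fun q => hFb k q).trans ?_
    rw [setIntegral_const, hvol, one_smul]
  have h := (hasSum_integral_of_summable_integral_norm hint hsum).tsum_eq
  have e : ∀ q : ℝ × ℝ, (∑' k : ℕ+ × ℕ+, B k * (Real.sin (Real.pi * (k.1 : ℝ) * q.1) *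
      Real.sin (Real.pi * (k.2 : ℝ) * q.2))) * Real.sin (Real.pi * (l.1 : ℝ) * q.1) *
      Real.sin (Real.pi * (l.2 : ℝ) * q.2) = ∑' k, F k q := fun q => by
    rw [← tsum_mul_right, ← tsum_mul_right]
    exact tsum_congr fun k => by simp only [hF]; ring
  simp only [e]
  rw [← h]
  simp only [hF, integral_const_mul, integral_sine_products]
  rw [tsum_eq_single l fun k hk => by simp [hk]]
  simp [div_eq_mul_inv]

theorem seriesSolution_initial {κ : ℝ} {A : ℕ+ → ℕ+ → ℝ}
    (hA : Summable fun k : ℕ+ × ℕ+ => ((k.1 : ℝ) ^ 2 + (k.2 : ℝ) ^ 2) * |A k.1 k.2|)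
    {h : ℂ → ℝ} (hc : ContinuousOn h (closure kochDomain)) (h0 : ∀ z ∈ kochBoundary, h z = 0)
    (hcoef : ∀ m n, A m n = fourierCoefficient h m n) {x y : ℝ}
    (hxy : (⟨x, y⟩ : ℂ) ∈ closure kochDomain) :
    seriesSolution κ A ![0, x, y] = h ⟨x, y⟩ := by
  have hfront : ∀ z ∈ frontier kochDomain, h z = 0 := fun z hz => by
    rw [isOpen_kochDomain.frontier_eq] at hz
    exact h0 z ((closure_kochDomain_subset hz.1).resolve_left hz.2)
  have hind : Continuous (kochDomain.indicator h) := continuous_indicator hfront hc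
  set s : ℝ × ℝ → ℝ := fun q => ∑' k : ℕ+ × ℕ+, A k.1 k.2 *
    (Real.sin (Real.pi * (k.1 : ℝ) * q.1) * Real.sin (Real.pi * (k.2 : ℝ) * q.2)) with hs
  have hsc : Continuous s := by
    refine continuous_tsum (fun k => by fun_prop) (summable_coefficient hA) fun k q => ?_
    rw [norm_mul, norm_mul]
    exact mul_le_of_le_one_right (abs_nonneg _) (mul_le_one₀ (Real.abs_sin_le_one _)
      (norm_nonneg _) (Real.abs_sin_le_one _))
  set g : ℝ × ℝ → ℝ := fun q => kochDomain.indicator h (unscale q) with hg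
  have hgc : Continuous g := hind.comp continuous_unscale
  have hzero : ∀ q ∈ unitSquare, s q - g q = 0 := by
    refine fun q hq => eq_zero_of_sine_coefficients (hsc.sub hgc) (fun m n => ?_) hq
    have hint : ∀ f : ℝ × ℝ → ℝ, Continuous f → IntegrableOn (fun q : ℝ × ℝ => f q *
        Real.sin (Real.pi * (m : ℝ) * q.1) * Real.sin (Real.pi * (n : ℝ) * q.2)) unitSquare :=
      fun f hf => (Continuous.continuousOn (by fun_prop)).integrableOn_compact isCompact_unitSquare
    have h1 : ∫ q in unitSquare, s q * Real.sin (Real.pi * (m : ℝ) * q.1) *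
        Real.sin (Real.pi * (n : ℝ) * q.2) = A m n / 4 :=
      integral_tsum_sine_products (summable_coefficient hA) (m, n)
    have h2 := hcoef m n
    rw [fourierCoefficient_eq, ← setIntegral_eq_integral_of_forall_compl_eq_zero
      (s := unitSquare) fun q hq => by
        rw [Set.indicator_of_notMem fun hD => hq (mem_unitSquare_of_unscale_mem hD), zero_mul,
          zero_mul]] at h2
    simp only [Pi.sub_apply, sub_mul]
    rw [integral_sub (hint s hsc) (hint g hgc), h1]
    linarith
  have hseries : seriesSolution κ A ![0, x, y] =
      s (staircase (-1 / 3) x, staircase (-1 / 3) y) := by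
    have e0 : scalingVar 0 = staircase 0 := rfl
    have e1 : scalingVar 1 = staircase (-1 / 3) := rfl
    have e2 : scalingVar 2 = staircase (-1 / 3) := rfl
    refine tsum_congr fun k => ?_
    simp [seriesTerm, e0, e1, e2, staircase_self, mul_assoc]
  -- the point lies in the closed square
  have hsq : (staircase (-1 / 3) x, staircase (-1 / 3) y) ∈ unitSquare := by
    have hcl : IsClosed {z : ℂ | (staircase (-1 / 3) z.re, staircase (-1 / 3) z.im) ∈ unitSquare} :=
      isCompact_unitSquare.isClosed.preimage
        (((continuous_staircase _).comp Complex.continuous_re).prodMk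
          ((continuous_staircase _).comp Complex.continuous_im))
    refine closure_minimal (fun z hz => ?_) hcl hxy
    refine mem_unitSquare_of_unscale_mem ?_
    rwa [unscale_staircase]
  have hfin := sub_eq_zero.1 (hzero _ hsq)
  rw [hseries, hfin, hg]
  simp only [unscale_staircase]
  rcases closure_kochDomain_subset hxy with hD | hΓ
  · rw [Set.indicator_of_mem hD]
  · by_cases hD : (⟨x, y⟩ : ℂ) ∈ kochDomain
    · rw [Set.indicator_of_mem hD]
    · rw [Set.indicator_of_notMem hD, h0 _ hΓ]

end KochWave

open KochWave in
theorem mainTheorem9 :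
    -- the scaling variables are continuous strictly increasing staircases
    (∀ p : ℝ, Continuous (staircase p) ∧ StrictMono (staircase p) ∧ staircase p p = 0 ∧
      ∀ ξ : ℝ, staircase p (ξ + 5 / 3) = staircase p ξ + 1) ∧
    -- the mass of `Γ` is distributed along both axes in the same way
    (∀ a b : ℝ, Measure.hausdorffMeasure (3 / 2 : ℝ) (kochBoundary ∩ Complex.re ⁻¹' Set.Ioo a b) =
      Measure.hausdorffMeasure (3 / 2 : ℝ) (kochBoundary ∩ Complex.im ⁻¹' Set.Ioo a b)) ∧
    IsOpen waveCylinder ∧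
    -- the renormalization turns the wave equation into the fractal wave equation
    (∀ (c κ : ℝ), 0 < c → 0 < κ → ∀ (S : Set (Fin 3 → ℝ)), IsOpen S →
      ∀ u : (Fin 3 → ℝ) → ℝ, ContDiffOn ℝ 2 u (renormalize c κ '' S) →
        FractalContDiffOn 2 (fun p => u (renormalize c κ p)) S ∧
        ∀ p ∈ S, (FractalWaveAt κ (fun p => u (renormalize c κ p)) p ↔
          ClassicalWaveAt c u (renormalize c κ p))) ∧
    -- smooth initial data supported in `D` have rapidly decreasing coefficients
    (∀ h : ℂ → ℝ, tsupport h ⊆ kochDomain →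
      FractalContDiffOn 5 (fun p => h ⟨p 1, p 2⟩) Set.univ →
        Summable (fun k : ℕ+ × ℕ+ =>
          ((k.1 : ℝ) ^ 2 + (k.2 : ℝ) ^ 2) * |fourierCoefficient h k.1 k.2|)) ∧
    -- the series solution of the fractal wave equation
    (∀ (κ : ℝ), 0 < κ → ∀ A : ℕ+ → ℕ+ → ℝ,
      Summable (fun k : ℕ+ × ℕ+ => ((k.1 : ℝ) ^ 2 + (k.2 : ℝ) ^ 2) * |A k.1 k.2|) →
        (∀ p, Summable (seriesTerm κ A p)) ∧
        Continuous (seriesSolution κ A) ∧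
        FractalContDiffOn 2 (seriesSolution κ A) Set.univ ∧
        (∀ p, FractalWaveAt κ (seriesSolution κ A) p) ∧
        (∀ p, p 0 = 0 → HasFractalPartialAt 0 (seriesSolution κ A) 0 p) ∧
        (∀ p, (p 1 = -1 / 3 ∨ p 1 = 4 / 3 ∨ p 2 = -1 / 3 ∨ p 2 = 4 / 3) →
          seriesSolution κ A p = 0) ∧
        (∀ h : ℂ → ℝ, ContinuousOn h (closure kochDomain) → (∀ z ∈ kochBoundary, h z = 0) →
          (∀ m n, A m n = fourierCoefficient h m n) →
            ∀ x y : ℝ, (⟨x, y⟩ : ℂ) ∈ closure kochDomain →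
              seriesSolution κ A ![0, x, y] = h ⟨x, y⟩)) := by
  refine ⟨fun p => ⟨continuous_staircase p, strictMono_staircase p, staircase_self p,
    staircase_add_period p⟩, fun a b => hausdorffMeasure_re_eq_im _, isOpen_waveCylinder,
    fun c κ hc hκ S hS u hu => renormalization hc hκ hS u hu,
    fun h hsupp hd => summable_fourierCoefficient hsupp hd, fun κ hκ A hA => ?_⟩
  refine ⟨fun p => ?_, continuous_seriesSolution κ hA, fractalContDiffOn_seriesSolution hκ hA,
    fractalWaveAt_seriesSolution hκ hA, fun p hp => hasFractalPartialAt_zero_seriesSolution hκ hA hp,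
    fun p hp => seriesSolution_eq_zero_of_edge κ A hp,
    fun h hc h0 hcoef x y hxy => seriesSolution_initial hA hc h0 hcoef hxy⟩
  simpa only [← seriesTerm_eq] using summable_trigTerm (lam := waveFrequency κ)
    (summable_coefficient hA) wavePhase (scaling p)
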